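/- Let $F_n$ be the free group with basis $x_1,\dots,x_n$, let $X=\{x_1,\dots,x_n,\bar x_1,\dots,\bar x_n\}$ (where $\bar x_i=x_i^{-1}$) be its set of letters, and let $H\le F_n$ be a subgroup. The *covering graph* of $H$ is the covering of the rose with $n$ petals $x_1,\dots,x_n$ that corresponds to $H$: its vertices are the cosets $Hw$, and for every vertex $Hw$ and every $i$ there is one oriented edge labeled $x_i$ from $Hw$ to $Hwx_i$. The *core graph* $\mathrm{Core}(H)$ is the subgraph of the covering graph that is the union of all its non-degenerate loops, i.e. of the images of all locally injective maps from the circle (equivalently, of all cyclically reduced closed edge paths of positive length). For a vertex $v$ of $\mathrm{Core}(H)$ let $L(v)\subseteq X$ be the set of letters at $v$: $x_i\in L(v)$ if and only if an edge of $\mathrm{Core}(H)$ labeled $x_i$ comes out of $v$, and $\bar x_i\in L(v)$ if and only if an edge of $\mathrm{Core}(H)$ labeled $x_i$ goes into $v$. The *Whitehead graph* of $H$ has vertex set $X$, and two distinct letters $y,z$ are joined if and only if $y,z\in L(v)$ for some vertex $v$ of $\mathrm{Core}(H)$. A vertex $a$ of the Whitehead graph is a *cut vertex* if it is not isolated and its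 connected component either does not contain $\bar a$ or becomes disconnected when $a$ is removed. For $a\in X$ and $A\subseteq X\setminus\{a,\bar a\}$, the *Whitehead automorphism* $\varphi=(A,a)$ of $F_n$ fixes $a$ and sends each generator $x_j\ne a,\bar a$ to $a^{\varepsilon}x_j\bar a^{\delta}$, where $\varepsilon=1$ if $x_j\in A$ and $\varepsilon=0$ otherwise, and $\delta=1$ if $\bar x_j\in A$ and $\delta=0$ otherwise. A subgroup $H\le F_n$ is a *free factor* if some basis of $H$ can be extended to a basis of $F_n$. **Theorem.** Let $H\le F_n$ be a free factor. (1) If $\mathrm{Core}(H)$ has more than one vertex, then the Whitehead graph of $H$ contains a cut vertex. (2) If the Whitehead graph of $H$ contains a cut vertex (in particular, by (1), if $\mathrm{Core}(H)$ has more than one vertex), then there is a Whitehead automorphism $\varphi=(A,a)$ such that $\mathrm{Core}(\varphi(H))$ has strictly fewer vertices and strictly fewer edges than $\mathrm{Core}(H)$ and, moreover, at each vertex $v$ of $\mathrm{Core}(H)$ exactly one of the following holds: - (i) $L(v)\cap A=\emptyset$; - (ii) $L(v)\subseteq A$; - (iii) $a\in L(v)$ and $L(v)\subseteq A\cup\{a\}$.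 -/

import Mathlib

/-- A letter `x₁, …, xₙ, x₁⁻¹, …, xₙ⁻¹`: the pair `(i, true)` stands for `xᵢ` and `(i, false)` for
its inverse. -/
abbrev Letter (n : ℕ) : Type := Fin n × Bool

namespace Letter

/-- The inverse letter. -/
def inv {n : ℕ} (y : Letter n) : Letter n := (y.1, !y.2)

/-- The element of the free group `F_n` represented by a letter. -/
def toFree {n : ℕ} (y : Letter n) : FreeGroup (Fin n) :=
  if y.2 then FreeGroup.of y.1 else (FreeGroup.of y.1)⁻¹

theorem toFree_inv {n : ℕ} (y : Letter n) : y.inv.toFree = y.toFree⁻¹ := by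
  rcases y with ⟨i, _ | _⟩ <;> simp [inv, toFree]

end Letter

/-- A subgroup `H` of `G` is a free factor if some basis of `H` can be extended to a basis
of `G`. -/
def IsFreeFactor {G : Type} [Group G] (H : Subgroup G) : Prop :=
  ∃ (ι κ : Type) (bH : FreeGroupBasis ι H) (bG : FreeGroupBasis (ι ⊕ κ) G),
    ∀ i : ι, bG (Sum.inl i) = (bH i : G)

/-- A graph labeled over the rose with `n` petals: every edge has an orientation (from `src` to
`tgt`) and a label in `{x₁, …, xₙ}`. Loops and multiple edges are allowed. -/
structure RoseGraph (n : ℕ) where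
  /-- the vertices -/
  V : Type
  /-- the edges -/
  E : Type
  /-- the initial vertex of an edge -/
  src : E → V
  /-- the terminal vertex of an edge -/
  tgt : E → V
  /-- the label of an edge -/
  label : E → Fin n

namespace RoseGraph

variable {n : ℕ} (G : RoseGraph n)

/-- An edge together with a direction in which it is crossed: `(e, true)` crosses `e` along its
orientation and `(e, false)` crosses it backwards. -/
abbrev Dart : Type := G.E × Bool

/-- The vertex at which the crossing of an edge begins. -/
def start (d : G.Dart) : G.V := if d.2 then G.src d.1 else G.tgt d.1

/-- The vertex at which the crossing of an edge ends. -/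
def finish (d : G.Dart) : G.V := if d.2 then G.tgt d.1 else G.src d.1

/-- A non-degenerate loop: a closed edge path `d 0, …, d (m - 1)` of length `m > 0`, continued
periodically, which never crosses the same edge twice in a row in opposite directions (also not
where it closes up). These are the locally injective maps from the circle to the graph, up to
reparametrization. -/
structure IsLoop (m : ℕ) (d : ℕ → G.Dart) : Prop where
  pos : 0 < m
  periodic : ∀ k, d (k + m) = d k
  consecutive : ∀ k, G.finish (d k) = G.start (d (k + 1))
  noBacktrack : ∀ k, d (k + 1) ≠ ((d k).1, !(d k).2)

/-- The vertex `v` lies on a non-degenerate loop. -/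
def VertexInCore (v : G.V) : Prop :=
  ∃ (m : ℕ) (d : ℕ → G.Dart), G.IsLoop m d ∧ ∃ k, G.start (d k) = v

/-- The edge `e` lies on a non-degenerate loop. -/
def EdgeInCore (e : G.E) : Prop :=
  ∃ (m : ℕ) (d : ℕ → G.Dart), G.IsLoop m d ∧ ∃ k, (d k).1 = e

theorem vertexInCore_src {e : G.E} (h : G.EdgeInCore e) : G.VertexInCore (G.src e) := by
  obtain ⟨m, d, hd, k, hk⟩ := h
  have hc := hd.consecutive k
  rcases hb : (d k).2 with _ | _
  · exact ⟨m, d, hd, k + 1, by rw [← hc]; simp [finish, hb, hk]⟩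
  · exact ⟨m, d, hd, k, by simp [start, hb, hk]⟩

theorem vertexInCore_tgt {e : G.E} (h : G.EdgeInCore e) : G.VertexInCore (G.tgt e) := by
  obtain ⟨m, d, hd, k, hk⟩ := h
  have hc := hd.consecutive k
  rcases hb : (d k).2 with _ | _
  · exact ⟨m, d, hd, k, by simp [start, hb, hk]⟩
  · exact ⟨m, d, hd, k + 1, by rw [← hc]; simp [finish, hb, hk]⟩

/-- The core of a graph: the subgraph given by the union of its non-degenerate loops. -/
def core : RoseGraph n where
  V := {v : G.V // G.VertexInCore v}
  E := {e : G.E // G.EdgeInCore e}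
  src e := ⟨G.src e.1, G.vertexInCore_src e.2⟩
  tgt e := ⟨G.tgt e.1, G.vertexInCore_tgt e.2⟩
  label e := G.label e.1

/-- The set `L(v)` of letters at the vertex `v`: it contains `xᵢ` if an edge labeled `xᵢ` comes out
of `v`, and the inverse of `xᵢ` if an edge labeled `xᵢ` goes into `v`. -/
def letters (v : G.V) : Set (Letter n) :=
  {y | ∃ e : G.E, G.label e = y.1 ∧ G.start (e, y.2) = v}

/-- The Whitehead graph: its vertices are the `2n` letters, and two distinct letters are joined if
both are letters at some vertex `v`. (Multiplicities of arcs are not recorded.) -/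
def whiteheadGraph : SimpleGraph (Letter n) where
  Adj y z := y ≠ z ∧ ∃ v : G.V, y ∈ G.letters v ∧ z ∈ G.letters v
  symm := ⟨fun _ _ h => ⟨h.1.symm, h.2.imp fun _ hv => ⟨hv.2, hv.1⟩⟩⟩
  loopless := ⟨fun _ h => h.1 rfl⟩

end RoseGraph

/-- The letter `a` is a cut vertex of the graph `W` on the set of letters: it is not isolated, and
its connected component either does not contain the inverse of `a` or becomes disconnected when `a`
is removed. -/
def IsCutVertex {n : ℕ} (W : SimpleGraph (Letter n)) (a : Letter n) : Prop :=
  (∃ y, W.Adj a y) ∧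
    (¬ W.Reachable a a.inv ∨ ¬ (W.induce {y | W.Reachable a y ∧ y ≠ a}).Connected)

/-- The covering graph of the rose which corresponds to the subgroup `H` of `F_n`: its vertices are
the cosets `H w`, and for each `i` there is one edge labeled `xᵢ` from `H w` to `H w xᵢ`. The paths
starting at the base vertex `H` are determined by the words they read, and the path reading `w` is
closed if and only if `w ∈ H`. -/
def coveringGraph {n : ℕ} (H : Subgroup (FreeGroup (Fin n))) : RoseGraph n where
  V := Quotient (QuotientGroup.rightRel H)
  E := Quotient (QuotientGroup.rightRel H) × Fin n
  src e := e.1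
  tgt e := Quotient.map (fun w => w * FreeGroup.of e.2)
    (fun u v (h : QuotientGroup.rightRel H u v) => by
      change QuotientGroup.rightRel H _ _
      rw [QuotientGroup.rightRel_apply] at h ⊢
      simpa [mul_assoc] using h) e.1
  label e := e.2

/-- The core graph `Core(H)` of a subgroup `H` of `F_n`. -/
def coreGraph {n : ℕ} (H : Subgroup (FreeGroup (Fin n))) : RoseGraph n :=
  (coveringGraph H).core

/-- A pair `(A, a)` defining a Whitehead automorphism: the acting letter `a` and a set `A` of
letters different from `a` and its inverse. -/
structure WhiteheadPair (n : ℕ) where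
  /-- the acting letter -/
  a : Letter n
  /-- the set of letters we act on -/
  A : Finset (Letter n)
  a_notMem : a ∉ A
  inv_notMem : a.inv ∉ A

namespace WhiteheadPair

variable {n : ℕ}

/-- The endomorphism that fixes `a` and sends each other generator `x` to one of `x`, `a x`,
`x a⁻¹`, `a x a⁻¹`: there is a factor `a` on the left if `x ∈ A`, and a factor `a⁻¹` on the right
if `x⁻¹ ∈ A`. -/
def toHom (P : WhiteheadPair n) : FreeGroup (Fin n) →* FreeGroup (Fin n) :=
  FreeGroup.lift fun j =>
    if j = P.a.1 then FreeGroup.of j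
    else (if (j, true) ∈ P.A then P.a.toFree else 1) * FreeGroup.of j *
      (if (j, false) ∈ P.A then P.a.toFree⁻¹ else 1)

/-- The pair `(A, a⁻¹)`, which defines the inverse automorphism. -/
def invPair (P : WhiteheadPair n) : WhiteheadPair n where
  a := P.a.inv
  A := P.A
  a_notMem := P.inv_notMem
  inv_notMem := by simpa [Letter.inv] using P.a_notMem

theorem toHom_of (P : WhiteheadPair n) (j : Fin n) :
    P.toHom (FreeGroup.of j) = if j = P.a.1 then FreeGroup.of j
      else (if (j, true) ∈ P.A then P.a.toFree else 1) * FreeGroup.of j *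
        (if (j, false) ∈ P.A then P.a.toFree⁻¹ else 1) := by
  simp [toHom]

theorem toHom_a (P : WhiteheadPair n) : P.toHom P.a.toFree = P.a.toFree := by
  unfold Letter.toFree
  split_ifs <;> simp [toHom_of]

theorem toHom_comp_invPair (P : WhiteheadPair n) :
    P.toHom.comp P.invPair.toHom = MonoidHom.id _ := by
  ext j
  have h1 : P.invPair.a = P.a.inv := rfl
  have h2 : P.invPair.A = P.A := rfl
  have h3 : P.a.inv.1 = P.a.1 := rfl
  simp only [MonoidHom.comp_apply, MonoidHom.id_apply, toHom_of P.invPair, h1, h2, h3,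
    Letter.toFree_inv]
  by_cases hj : j = P.a.1
  · simp [toHom_of, hj]
  · by_cases ht : (j, true) ∈ P.A <;> by_cases hf : (j, false) ∈ P.A <;>
      simp [toHom_of, toHom_a, hj, ht, hf, mul_assoc]

theorem invPair_invPair (P : WhiteheadPair n) : P.invPair.invPair = P := by
  rcases P with ⟨⟨i, b⟩, A, h, h'⟩
  simp [invPair, Letter.inv]

/-- The Whitehead automorphism `(A, a)`. -/
def toAut (P : WhiteheadPair n) : FreeGroup (Fin n) ≃* FreeGroup (Fin n) :=
  P.toHom.toMulEquiv P.invPair.toHom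
    (by simpa only [invPair_invPair] using P.invPair.toHom_comp_invPair)
    P.toHom_comp_invPair

end WhiteheadPair

/-- Exactly one of three propositions holds. -/
def ExactlyOne (p q r : Prop) : Prop :=
  (p ∨ q ∨ r) ∧ ¬ (p ∧ q) ∧ ¬ (p ∧ r) ∧ ¬ (q ∧ r)

/-- The trichotomy for the Whitehead automorphism `(A, a)` at the vertex `v`. -/
def Trichotomy {n : ℕ} (P : WhiteheadPair n) (G : RoseGraph n) (v : G.V) : Prop :=
  ExactlyOne (G.letters v ∩ (P.A : Set (Letter n)) = ∅)
    (G.letters v ⊆ (P.A : Set (Letter n)))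
    (P.a ∈ G.letters v ∧ G.letters v ⊆ (P.A : Set (Letter n)) ∪ {P.a})

/-- The core graph of the image of `H` under the Whitehead automorphism `(A, a)` has strictly fewer
vertices and strictly fewer edges than the core graph of `H`. -/
def StrictlyReduces {n : ℕ} (P : WhiteheadPair n) (H : Subgroup (FreeGroup (Fin n))) : Prop :=
  ENat.card (coreGraph (H.map P.toAut.toMonoidHom)).V < ENat.card (coreGraph H).V ∧
    ENat.card (coreGraph (H.map P.toAut.toMonoidHom)).E < ENat.card (coreGraph H).E

/-! Existence of a cut vertex is an Euler characteristic argument with Stallings folds. At a vertex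
of the core, attach loops reading (conjugates of) the elements that complete a basis of `H` to one
of `F_n`. The resulting graph `G` is `Full`: every element of `F_n` can be read between any two
vertices. It also satisfies `E + 1 ≤ V + n`, since the core has at most `V - 1 + rank H` edges
(`card_coreGraph_E_le`). Full finite graphs satisfy the opposite inequality (`Full.card_le`), so `G`
is extremal. Hence it has no parallel edges with equal labels, and every fold loses exactly one
vertex and one edge. A folded full graph has one vertex (`Full.subsingleton_of_folded`), so some
fold is the first to bring the whole core to one vertex. Colour the vertices of the core by their
images just before that fold. Afterwards each label occurs on at most one edge in the image of the
core. Hence, before it, all occurrences of a letter sit at one colour, except for the single letter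
`s` at the two distinct ends of the folded edges (`exists_colouring`). A colour is therefore
constant along walks of the Whitehead graph that avoid `s`, and this exhibits a cut vertex
(`exists_isCutVertex_of_colouring`).

Reduction: a cut vertex `a` gives a set `A` avoiding `a` and its inverse, from which the arcs of the
Whitehead graph leave only towards `a` (`IsCutVertex.exists_set`). So every vertex of the core that
has a letter in `A` has all its letters in `A ∪ {a}`. Move the image of each such vertex by `a`. The
factors `a` introduced by `φ` then cancel: every edge keeps its label, except that the `a`-edges
leaving moved vertices collapse (`Splits.reads_letter`). What remains contains the core of `φ(H)`
(`Splits.imageDart_of_inCore`), and at least one edge has collapsed because `a` has a neighbour in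
`A` (`Splits.strictlyReduces`). -/

open FreeGroup

/-! ### Letters and reduced words. -/

namespace Letter
variable {n : ℕ}

@[simp] theorem inv_inv (y : Letter n) : y.inv.inv = y := by simp [inv]

theorem inv_ne (y : Letter n) : y.inv ≠ y := by
  rcases y with ⟨i, _ | _⟩ <;> simp [inv]

theorem mk_singleton (y : Letter n) : FreeGroup.mk [y] = y.toFree := by
  rcases y with ⟨i, _ | _⟩ <;> simp [toFree, FreeGroup.of, FreeGroup.inv_mk, FreeGroup.invRev]

theorem mk_inv (y : Letter n) : FreeGroup.mk [y.inv] = (FreeGroup.mk [y])⁻¹ := by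
  simp [FreeGroup.inv_mk, FreeGroup.invRev, inv]

theorem compat_iff (y z : Letter n) : (y.1 = z.1 → y.2 = z.2) ↔ z ≠ y.inv := by
  rcases y with ⟨i, _ | _⟩ <;> rcases z with ⟨j, _ | _⟩ <;> simp [inv, eq_comm]

end Letter

section Words
variable {n : ℕ}

theorem isReduced_append {l₁ l₂ : List (Letter n)} (h₁ : IsReduced l₁) (h₂ : IsReduced l₂)
    (h : ∀ x ∈ l₁.getLast?, ∀ y ∈ l₂.head?, y ≠ x.inv) : IsReduced (l₁ ++ l₂) :=
  List.isChain_append.2 ⟨h₁, h₂, fun x hx y hy => (Letter.compat_iff x y).2 (h x hx y hy)⟩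

theorem isReduced_letter_cons_cons {y z : Letter n} {l : List (Letter n)} :
    IsReduced (y :: z :: l) ↔ z ≠ y.inv ∧ IsReduced (z :: l) := by
  rw [← Letter.compat_iff]
  exact List.isChain_cons_cons

theorem invRev_letter_cons (y : Letter n) (l : List (Letter n)) :
    invRev (y :: l) = invRev l ++ [y.inv] := by
  simp [invRev, Letter.inv]

theorem head?_invRev (l : List (Letter n)) : (invRev l).head? = l.getLast?.map Letter.inv := by
  induction l using List.reverseRecOn with
  | nil => rfl
  | append_singleton l a => simp [invRev, Letter.inv]

theorem getLast?_invRev (l : List (Letter n)) : (invRev l).getLast? = l.head?.map Letter.inv := by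
  cases l with
  | nil => rfl
  | cons a l => simp [invRev, Letter.inv]

theorem isReduced_invRev {l : List (Letter n)} (h : IsReduced l) : IsReduced (invRev l) := by
  have h1 : l = (FreeGroup.mk l).toWord := by rw [toWord_mk, h.reduce_eq]
  rw [h1, ← toWord_inv]
  exact isReduced_toWord

end Words

/-! ### Loops and reduced paths in the covering graph, described by words. -/

section Cosets
variable {n : ℕ} {H : Subgroup (FreeGroup (Fin n))}

/-- The right action of `F_n` on the cosets `H w`. -/
def cosetAct (v : (coveringGraph H).V) (g : FreeGroup (Fin n)) : (coveringGraph H).V :=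
  Quotient.map (fun w => w * g)
    (fun u v (h : QuotientGroup.rightRel H u v) => by
      change QuotientGroup.rightRel H _ _
      rw [QuotientGroup.rightRel_apply] at h ⊢
      simpa [mul_assoc] using h) v

infixl:70 " ◃ " => cosetAct

/-- The coset `H g`. -/
def cosetMk (H : Subgroup (FreeGroup (Fin n))) (g : FreeGroup (Fin n)) : (coveringGraph H).V :=
  Quotient.mk (QuotientGroup.rightRel H) g

theorem cosetMk_act (g h : FreeGroup (Fin n)) : cosetMk H g ◃ h = cosetMk H (g * h) := rfl

theorem cosetMk_surjective : Function.Surjective (cosetMk H) := Quotient.mk_surjective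

theorem cosetMk_eq {g h : FreeGroup (Fin n)} : cosetMk H g = cosetMk H h ↔ h * g⁻¹ ∈ H :=
  Quotient.eq.trans QuotientGroup.rightRel_apply

theorem act_act (v : (coveringGraph H).V) (g h : FreeGroup (Fin n)) : v ◃ g ◃ h = v ◃ (g * h) := by
  obtain ⟨w, rfl⟩ := cosetMk_surjective v
  simp [cosetMk_act, mul_assoc]

@[simp] theorem act_one (v : (coveringGraph H).V) : v ◃ 1 = v := by
  obtain ⟨w, rfl⟩ := cosetMk_surjective v
  simp [cosetMk_act]

theorem exists_act_eq (u v : (coveringGraph H).V) : ∃ g, u ◃ g = v := by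
  obtain ⟨a, rfl⟩ := cosetMk_surjective u
  obtain ⟨b, rfl⟩ := cosetMk_surjective v
  exact ⟨a⁻¹ * b, by simp [cosetMk_act]⟩

theorem act_mk_append (v : (coveringGraph H).V) (a b : List (Letter n)) :
    v ◃ FreeGroup.mk (a ++ b) = v ◃ FreeGroup.mk a ◃ FreeGroup.mk b := by
  rw [act_act, FreeGroup.mul_mk]

theorem act_mk_cons (v : (coveringGraph H).V) (y : Letter n) (b : List (Letter n)) :
    v ◃ FreeGroup.mk (y :: b) = v ◃ FreeGroup.mk [y] ◃ FreeGroup.mk b :=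
  act_mk_append v [y] b

@[simp] theorem act_mk_nil (v : (coveringGraph H).V) : v ◃ FreeGroup.mk [] = v := by
  rw [← FreeGroup.one_eq_mk, act_one]

@[simp] theorem act_letter_inv (v : (coveringGraph H).V) (y : Letter n) :
    v ◃ FreeGroup.mk [y] ◃ FreeGroup.mk [y.inv] = v := by
  rw [act_act, Letter.mk_inv, mul_inv_cancel, act_one]

@[simp] theorem act_inv_letter (v : (coveringGraph H).V) (y : Letter n) :
    v ◃ FreeGroup.mk [y.inv] ◃ FreeGroup.mk [y] = v := by
  rw [act_act, Letter.mk_inv, inv_mul_cancel, act_one]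

theorem act_invRev (v : (coveringGraph H).V) (p : List (Letter n)) :
    v ◃ FreeGroup.mk p ◃ FreeGroup.mk (invRev p) = v := by
  rw [act_act, ← FreeGroup.inv_mk, mul_inv_cancel, act_one]

/-- A nonempty cyclically reduced word which labels a closed path at `v`. -/
structure IsLoopWord (v : (coveringGraph H).V) (w : List (Letter n)) : Prop where
  ne_nil : w ≠ []
  reduced : IsReduced (w ++ w)
  closed : v ◃ FreeGroup.mk w = v

/-- The edge that leaves `v` along the letter `y` lies on a non-degenerate loop. -/
def InCore (v : (coveringGraph H).V) (y : Letter n) : Prop :=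
  ∃ t, IsLoopWord v (y :: t)

theorem IsLoopWord.rotate {v : (coveringGraph H).V} {a b : List (Letter n)}
    (h : IsLoopWord v (a ++ b)) : IsLoopWord (v ◃ FreeGroup.mk a) (b ++ a) where
  ne_nil := by have := h.ne_nil; aesop
  reduced := by
    have h3 : IsReduced ((a ++ b) ++ (a ++ b) ++ (a ++ b)) :=
      h.reduced.append_overlap h.reduced h.ne_nil
    exact h3.infix ⟨a, b, by simp⟩
  closed := by rw [act_mk_append, ← act_mk_append v, h.closed]

theorem IsLoopWord.isReduced {v : (coveringGraph H).V} {w : List (Letter n)}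
    (h : IsLoopWord v w) : IsReduced w :=
  h.reduced.infix ⟨[], w, by simp⟩

theorem IsLoopWord.invRev {v : (coveringGraph H).V} {w : List (Letter n)}
    (h : IsLoopWord v w) : IsLoopWord v (invRev w) where
  ne_nil := by
    have := h.ne_nil
    simpa [FreeGroup.invRev] using this
  reduced := by
    rw [← FreeGroup.invRev_append]
    exact isReduced_invRev h.reduced
  closed := by
    conv_lhs => rw [← h.closed]
    exact act_invRev v w

theorem IsLoopWord.inCore_head {v : (coveringGraph H).V} {w : List (Letter n)}
    (h : IsLoopWord v w) : ∀ y ∈ w.head?, InCore v y := by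
  intro y hy
  cases w with
  | nil => simp at hy
  | cons a t => obtain rfl : a = y := by simpa using hy
                exact ⟨t, h⟩

theorem IsLoopWord.inCore_getLast {v : (coveringGraph H).V} {w : List (Letter n)}
    (h : IsLoopWord v w) : ∀ y ∈ w.getLast?, InCore v y.inv := by
  intro y hy
  refine h.invRev.inCore_head y.inv ?_
  rw [head?_invRev]
  exact Option.mem_map_of_mem _ hy

theorem InCore.inv {v : (coveringGraph H).V} {y : Letter n} (h : InCore v y) :
    InCore (v ◃ FreeGroup.mk [y]) y.inv := by
  obtain ⟨t, ht⟩ := h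
  exact (IsLoopWord.rotate (a := [y]) (b := t) ht).inCore_getLast y (by simp)

/-- Core vertices have valence at least two: the edge by which the loop returns, read backwards,
differs from the one by which it left because the word is cyclically reduced. -/
theorem InCore.exists_ne {v : (coveringGraph H).V} {y : Letter n} (h : InCore v y) :
    ∃ z, z ≠ y ∧ InCore v z := by
  obtain ⟨t, ht⟩ := h
  rcases List.eq_nil_or_concat' (y :: t) with h0 | ⟨s, z, hz⟩
  · simp at h0
  refine ⟨z.inv, ?_, ht.inCore_getLast z (by simp [hz])⟩
  intro hzy
  have hr := ht.reduced
  have h2 : IsReduced [z, y] := by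
    refine hr.infix ⟨s, t, ?_⟩
    conv_rhs => rw [show y :: t ++ y :: t = (y :: t) ++ ([y] ++ t) by simp, hz]
    simp
  exact (isReduced_letter_cons_cons.1 h2).1 hzy.symm

/-- The path which starts at `v` and reads the word stays in the set `D` of directed edges. -/
def Reads (D : (coveringGraph H).V → Letter n → Prop) :
    (coveringGraph H).V → List (Letter n) → Prop
  | _, [] => True
  | v, y :: w => D v y ∧ Reads D (v ◃ FreeGroup.mk [y]) w

variable {D : (coveringGraph H).V → Letter n → Prop}

theorem reads_append {v : (coveringGraph H).V} {a b : List (Letter n)} :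
    Reads D v (a ++ b) ↔ Reads D v a ∧ Reads D (v ◃ FreeGroup.mk a) b := by
  induction a generalizing v with
  | nil => simp [Reads]
  | cons y a ih => simp [Reads, ih, act_mk_cons v y a, and_assoc]

theorem reads_invRev (hD : ∀ v y, D v y → D (v ◃ FreeGroup.mk [y]) y.inv)
    {v : (coveringGraph H).V} {w : List (Letter n)} (h : Reads D v w) :
    Reads D (v ◃ FreeGroup.mk w) (invRev w) := by
  induction w generalizing v with
  | nil => simp [Reads]
  | cons y w ih =>
    rw [invRev_letter_cons, reads_append, act_mk_cons, act_invRev]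
    exact ⟨ih h.2, hD _ _ h.1, trivial⟩

/-- A cancelling pair of letters returns to the vertex where it began, so the rest of the path is
unaffected by its removal. -/
theorem reads_reduce {v : (coveringGraph H).V} {w : List (Letter n)} (h : Reads D v w) :
    Reads D v (reduce w) := by
  have key : ∀ {a b : List (Letter n)}, Red.Step a b → Reads D v a → Reads D v b := by
    rintro _ _ ⟨⟩ h
    rename_i L₁ L₂ x b
    rw [reads_append] at h ⊢
    refine ⟨h.1, ?_⟩
    have h2 := h.2.2.2
    have := act_letter_inv (v ◃ FreeGroup.mk L₁) (x, b)
    rw [Letter.inv] at this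
    rwa [this] at h2
  have hr : Red w (reduce w) := reduce.red
  generalize reduce w = w' at hr
  induction hr with
  | refl => exact h
  | tail _ hs ih => exact key hs ih

theorem reads_toWord_of_mk {v : (coveringGraph H).V} {w : List (Letter n)} (h : Reads D v w) :
    Reads D v (FreeGroup.mk w).toWord := by
  rw [toWord_mk]
  exact reads_reduce h

theorem reads_rotate {v : (coveringGraph H).V} {a b : List (Letter n)}
    (h : Reads D v (a ++ b)) (hc : v ◃ FreeGroup.mk (a ++ b) = v) :
    Reads D (v ◃ FreeGroup.mk a) (b ++ a) := by
  rw [reads_append] at h ⊢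
  rw [act_mk_append] at hc
  rw [hc]
  exact h.symm

theorem Reads.mono {D' : (coveringGraph H).V → Letter n → Prop} (hD : ∀ v y, D v y → D' v y)
    {v : (coveringGraph H).V} {w : List (Letter n)} (h : Reads D v w) : Reads D' v w := by
  induction w generalizing v with
  | nil => trivial
  | cons y w ih => exact ⟨hD _ _ h.1, ih h.2⟩

/-- Every edge of the loop is the first edge of a rotation of it. -/
theorem IsLoopWord.reads_inCore {v : (coveringGraph H).V} {w : List (Letter n)}
    (h : IsLoopWord v w) : Reads InCore v w := by
  have key : ∀ a b : List (Letter n), IsLoopWord v (b ++ a) →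
      Reads InCore (v ◃ FreeGroup.mk b) a := by
    intro a
    induction a with
    | nil => intros; trivial
    | cons y a ih =>
      intro b hb
      refine ⟨⟨a ++ b, hb.rotate⟩, ?_⟩
      rw [← act_mk_append]
      exact ih _ (by simpa using hb)
  simpa using key w [] h

/-- A reduced path between two vertices of the core stays in the core. -/
theorem reads_inCore {u v : (coveringGraph H).V} {y z : Letter n} {p : List (Letter n)}
    (hu : InCore u y) (hv : InCore v z) (hp : IsReduced p) (huv : u ◃ FreeGroup.mk p = v) :
    Reads InCore u p := by
  obtain ⟨N, hN⟩ : ∃ N, p.length = N := ⟨_, rfl⟩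
  induction N generalizing u v y z p with
  | zero => rw [List.length_eq_zero_iff.1 hN]; trivial
  | succ N ih =>
  by_cases h1 : ∃ a ∈ p.head?, InCore u a
  · obtain ⟨a, ha, hua⟩ := h1
    obtain ⟨t, rfl⟩ : ∃ t, p = a :: t := ⟨p.tail, (List.cons_head?_tail ha).symm⟩
    exact ⟨hua, ih hua.inv hv (hp.infix ⟨[a], [], by simp⟩) (by rw [← huv, ← act_mk_cons])
      (by simpa using hN)⟩
  by_cases h2 : ∃ a ∈ p.getLast?, InCore v a.inv
  · obtain ⟨a, ha, hva⟩ := h2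
    obtain ⟨t, rfl⟩ : ∃ t, p = t ++ [a] := ⟨p.dropLast, by
      rw [List.dropLast_append_getLast? a ha]⟩
    have hva' := hva.inv
    rw [← huv, act_mk_append] at hva'
    simp only [act_letter_inv, Letter.inv_inv] at hva'
    rw [reads_append]
    exact ⟨ih hu hva' (hp.infix ⟨[], [a], by simp⟩) rfl (by simpa using hN), hva', trivial⟩
  -- Neither the first nor the last edge of `p` lies in the core. So for loop words `a` at `u` and
  -- `b` at `v`, the word `p b p⁻¹ a` is cyclically reduced. It is a loop through the first edge of
  -- `p`, a contradiction.
  exfalso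
  push Not at h1 h2
  obtain ⟨s, hs⟩ := hu
  obtain ⟨t, ht⟩ := hv
  have hpn : p ≠ [] := by rintro rfl; simp at hN
  generalize y :: s = a at hs
  generalize z :: t = b at ht
  have j1 : IsReduced (p ++ b) := isReduced_append hp ht.isReduced fun x hx c hc hxc =>
    h2 x hx (hxc ▸ ht.inCore_head c hc)
  have hpi := isReduced_invRev hp
  have j2 : IsReduced (b ++ invRev p) := isReduced_append ht.isReduced hpi fun x hx c hc hxc => by
    rw [head?_invRev] at hc
    obtain ⟨d, hd, rfl⟩ : ∃ d, p.getLast? = some d ∧ d.inv = c := by simpa using hc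
    exact h2 d hd (hxc ▸ ht.inCore_getLast x hx)
  have j3 : IsReduced (invRev p ++ a) := isReduced_append hpi hs.isReduced fun x hx c hc hxc => by
    rw [getLast?_invRev] at hx
    obtain ⟨d, hd, rfl⟩ : ∃ d, p.head? = some d ∧ d.inv = x := by simpa using hx
    rw [Letter.inv_inv] at hxc
    exact h1 d hd (hxc ▸ hs.inCore_head c hc)
  have j4 : IsReduced (a ++ p) := isReduced_append hs.isReduced hp fun x hx c hc hxc =>
    h1 c hc (hxc ▸ hs.inCore_getLast x hx)
  have hin : invRev p ≠ [] := by simpa [FreeGroup.invRev] using hpn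
  have k1 : IsReduced (p ++ b ++ invRev p) := j1.append_overlap j2 ht.ne_nil
  have k2 : IsReduced (p ++ b ++ invRev p ++ a) := k1.append_overlap j3 hin
  have k3 : IsReduced (p ++ b ++ invRev p ++ a ++ p) := k2.append_overlap j4 hs.ne_nil
  have k4 : IsReduced (p ++ b ++ invRev p ++ a ++ p ++ (b ++ invRev p ++ a)) :=
    k3.append_overlap (by simpa using k2) hpn
  have hl : IsLoopWord u (p ++ b ++ invRev p ++ a) := by
    refine ⟨by simp [hpn], by simpa using k4, ?_⟩
    rw [act_mk_append, act_mk_append, act_mk_append, huv, ht.closed, ← huv, act_invRev, hs.closed]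
  obtain ⟨c, hc⟩ : ∃ c, p.head? = some c := by
    cases p with
    | nil => simp at hpn
    | cons c _ => exact ⟨c, rfl⟩
  exact h1 c hc (hl.inCore_head c (by simp [hc]))

/-- A set of directed edges contains the core as soon as it contains all closed reduced paths
at some base vertex. -/
theorem inCore_le (v₀ : (coveringGraph H).V) (h0 : ∀ g, v₀ ◃ g = v₀ → Reads D v₀ g.toWord)
    (v : (coveringGraph H).V) (y : Letter n) (hv : InCore v y) : D v y := by
  -- Induction on the length of a path `p` from `v₀` to the loop `w`. If `p` is not reduced, or `w`
  -- begins or ends along the last edge of `p`, reduce `p` or rotate `w` to shorten `p`. Otherwise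
  -- `p w p⁻¹` is a reduced closed path at `v₀`.
  have key : ∀ (N : ℕ) (p w : List (Letter n)), p.length = N →
      IsLoopWord (v₀ ◃ FreeGroup.mk p) w → Reads D (v₀ ◃ FreeGroup.mk p) w := by
    intro N
    induction N using Nat.strong_induction_on with
    | _ N ih =>
    intro p w hN hw
    by_cases hp : IsReduced p
    swap
    · have hne : reduce p ≠ p := fun h => hp (IsReduced.of_reduce_eq h)
      have hlt : (reduce p).length < p.length := by
        have hr : Red p (reduce p) := reduce.red
        refine lt_of_le_of_ne hr.length_le fun h => hne (hr.sublist.eq_of_length h)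
      have := ih _ (hN ▸ hlt) (reduce p) w rfl
      rw [reduce.self] at this
      exact this hw
    rcases List.eq_nil_or_concat' p with rfl | ⟨q, y, rfl⟩
    · rw [act_mk_nil] at hw ⊢
      have := h0 _ hw.closed
      rwa [toWord_mk, hw.isReduced.reduce_eq] at this
    have hqN : q.length < N := by rw [← hN]; simp
    by_cases h1 : y.inv ∈ w.head?
    · obtain ⟨t, rfl⟩ : ∃ t, w = [y.inv] ++ t := ⟨w.tail, (List.cons_head?_tail h1).symm⟩
      have hr := hw.rotate
      have hq : v₀ ◃ FreeGroup.mk (q ++ [y]) ◃ FreeGroup.mk [y.inv] = v₀ ◃ FreeGroup.mk q := by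
        rw [act_mk_append, act_letter_inv]
      rw [hq] at hr
      have := reads_rotate (ih _ hqN q _ rfl hr) hr.closed
      rwa [← hq, ← act_mk_append, hw.closed] at this
    by_cases h2 : y ∈ w.getLast?
    · obtain ⟨t, rfl⟩ : ∃ t, w = t ++ [y] := ⟨w.dropLast, by
        rw [List.dropLast_append_getLast? y h2]⟩
      have hr := hw.rotate
      have hq : v₀ ◃ FreeGroup.mk (q ++ [y]) ◃ FreeGroup.mk t = v₀ ◃ FreeGroup.mk q := by
        have h3 := hw.closed
        rw [act_mk_append] at h3
        have h4 := congrArg (· ◃ FreeGroup.mk [y.inv]) h3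
        simp only [act_letter_inv] at h4
        rw [h4, act_mk_append, act_letter_inv]
      rw [hq] at hr
      have := reads_rotate (ih _ hqN q _ rfl hr) hr.closed
      rwa [← act_mk_append] at this
    have hy : (q ++ [y]).getLast? = some y := by simp
    generalize q ++ [y] = p at *
    have j1 : IsReduced (p ++ w) := isReduced_append hp hw.isReduced fun x hx c hc hxc => by
      obtain rfl : y = x := by simpa [hy] using hx
      exact h1 (hxc ▸ hc)
    have j2 : IsReduced (w ++ invRev p) :=
      isReduced_append hw.isReduced (isReduced_invRev hp) fun x hx c hc hxc => by
        rw [head?_invRev, hy] at hc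
        obtain rfl : y.inv = c := by simpa using hc
        have := congrArg Letter.inv hxc
        simp only [Letter.inv_inv] at this
        exact h2 (this ▸ hx)
    have j3 := j1.append_overlap j2 hw.ne_nil
    have h3 := h0 (FreeGroup.mk (p ++ w ++ invRev p)) (by
      rw [act_mk_append, act_mk_append, hw.closed, act_invRev])
    rw [toWord_mk, j3.reduce_eq, reads_append, reads_append] at h3
    exact h3.1.2
  obtain ⟨g, hg⟩ := exists_act_eq v₀ v
  obtain ⟨t, ht⟩ := hv
  have := key _ g.toWord (y :: t) rfl
  rw [mk_toWord, hg] at this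
  exact (this ht).1

end Cosets

/-! ### Dictionary between edge paths of the covering graph and words. -/

section Translation
variable {n : ℕ} {H : Subgroup (FreeGroup (Fin n))}

/-- The letter which is read when an edge is crossed. -/
def dartLetter (d : (coveringGraph H).Dart) : Letter n := (d.1.2, d.2)

/-- The edge of the covering graph which leaves the vertex `v` along the letter `y`. -/
def dartAt (v : (coveringGraph H).V) (y : Letter n) : (coveringGraph H).Dart :=
  ((if y.2 then v else v ◃ FreeGroup.mk [y], y.1), y.2)

theorem tgt_eq_act (e : (coveringGraph H).E) :
    (coveringGraph H).tgt e = (coveringGraph H).src e ◃ FreeGroup.of e.2 := rfl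

theorem mk_true (i : Fin n) : FreeGroup.mk [(i, true)] = FreeGroup.of i := rfl

theorem mk_false (i : Fin n) : FreeGroup.mk [(i, false)] = (FreeGroup.of i)⁻¹ := by
  simp [FreeGroup.of, FreeGroup.inv_mk, FreeGroup.invRev]

theorem finish_eq (d : (coveringGraph H).Dart) :
    (coveringGraph H).finish d = (coveringGraph H).start d ◃ FreeGroup.mk [dartLetter d] := by
  rcases d with ⟨e, _ | _⟩
  · simp [RoseGraph.finish, RoseGraph.start, dartLetter, tgt_eq_act, mk_false, act_act]
  · simp [RoseGraph.finish, RoseGraph.start, dartLetter, tgt_eq_act, mk_true]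

@[simp] theorem start_dartAt (v : (coveringGraph H).V) (y : Letter n) :
    (coveringGraph H).start (dartAt v y) = v := by
  rcases y with ⟨i, _ | _⟩
  · change v ◃ _ ◃ _ = v
    change v ◃ FreeGroup.mk [(i, false)] ◃ FreeGroup.of i = v
    rw [mk_false, act_act, inv_mul_cancel, act_one]
  · simp [RoseGraph.start, dartAt]
    rfl

@[simp] theorem dartLetter_dartAt (v : (coveringGraph H).V) (y : Letter n) :
    dartLetter (dartAt v y) = y := rfl

theorem act_right_cancel {u v : (coveringGraph H).V} {g : FreeGroup (Fin n)}
    (h : u ◃ g = v ◃ g) : u = v := by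
  rw [← act_one u, ← mul_inv_cancel g, ← act_act, h, act_act, mul_inv_cancel, act_one]

theorem dart_ext {d d' : (coveringGraph H).Dart}
    (h : (coveringGraph H).start d = (coveringGraph H).start d')
    (h' : dartLetter d = dartLetter d') : d = d' := by
  rcases d with ⟨⟨v, i⟩, b⟩
  rcases d' with ⟨⟨v', i'⟩, b'⟩
  simp only [dartLetter, Prod.mk.injEq] at h'
  obtain ⟨rfl, rfl⟩ := h'
  cases b
  · have h2 : v ◃ FreeGroup.of i = v' ◃ FreeGroup.of i := h
    rw [act_right_cancel h2]
  · have h2 : v = v' := h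
    rw [h2]

theorem inCore_of_isLoop {m : ℕ} {d : ℕ → (coveringGraph H).Dart}
    (h : (coveringGraph H).IsLoop m d) (k : ℕ) :
    InCore ((coveringGraph H).start (d k)) (dartLetter (d k)) := by
  set l : ℕ → Letter n := fun j => dartLetter (d (k + j)) with hl
  have hper : ∀ j, l (j + m) = l j := fun j => by
    simp only [hl]; rw [← add_assoc, h.periodic]
  have hact : ∀ j, (coveringGraph H).start (d k) ◃ FreeGroup.mk ((List.range j).map l) =
      (coveringGraph H).start (d (k + j)) := by
    intro j
    induction j with
    | zero => simp
    | succ j ih =>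
      rw [List.range_succ, List.map_append, act_mk_append, ih, ← add_assoc, ← h.consecutive,
        finish_eq]
      rfl
  have hpos := h.pos
  obtain ⟨m', rfl⟩ : ∃ m', m = m' + 1 := ⟨m - 1, by omega⟩
  refine ⟨((List.range m').map Nat.succ).map l, ?_⟩
  have hw : dartLetter (d k) :: ((List.range m').map Nat.succ).map l =
      (List.range (m' + 1)).map l := by
    rw [List.range_succ_eq_map]; rfl
  rw [hw]
  refine ⟨by simp, ?_, ?_⟩
  · have h2 : (List.range (m' + 1)).map l ++ (List.range (m' + 1)).map l =
        (List.range ((m' + 1) + (m' + 1))).map l := by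
      rw [show List.range ((m' + 1) + (m' + 1)) = _ from List.range_add, List.map_append,
        List.map_map]
      congr 1
      refine List.map_congr_left fun j _ => ?_
      rw [Function.comp_apply, add_comm, hper]
    rw [h2]
    unfold FreeGroup.IsReduced
    rw [List.isChain_map, List.isChain_range]
    intro j _
    rw [Letter.compat_iff]
    intro hj
    refine h.noBacktrack (k + j) (dart_ext ?_ hj)
    rw [← h.consecutive]
    simp [RoseGraph.start, RoseGraph.finish]
    cases (d (k + j)).2 <;> simp
  · rw [hact, h.periodic]

theorem exists_isLoop_of_inCore {v : (coveringGraph H).V} {y : Letter n} (h : InCore v y) :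
    ∃ (m : ℕ) (d : ℕ → (coveringGraph H).Dart), (coveringGraph H).IsLoop m d ∧
      d 0 = dartAt v y := by
  obtain ⟨t, ht⟩ := h
  obtain ⟨w, hw⟩ : ∃ w, w = y :: t := ⟨_, rfl⟩
  rw [← hw] at ht
  have hm : 0 < w.length := by simp [hw]
  set m := w.length with hmdef
  set l : ℕ → Letter n := fun j => w[j % m]'(Nat.mod_lt _ hm) with hl
  set vt : ℕ → (coveringGraph H).V := fun j => Nat.rec v (fun j u => u ◃ FreeGroup.mk [l j]) j
    with hvt
  have hvt1 : ∀ j, vt (j + 1) = vt j ◃ FreeGroup.mk [l j] := fun j => rfl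
  have hlper : ∀ j, l (j + m) = l j := fun j => by simp [hl]
  have hvt2 : ∀ j ≤ m, vt j = v ◃ FreeGroup.mk (w.take j) := by
    intro j
    induction j with
    | zero => intro _; simp [hvt]
    | succ j ih =>
      intro hj
      rw [hvt1, ih (by omega), ← act_mk_append, List.take_succ_eq_append_getElem (by omega)]
      congr 5
      simp [hl, Nat.mod_eq_of_lt (show j < m by omega)]
  have hvtper : ∀ j, vt (j + m) = vt j := by
    intro j
    induction j with
    | zero =>
      rw [zero_add, hvt2 m le_rfl, hmdef, List.take_length, ht.closed, hvt2 0 (Nat.zero_le _)]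
      simp
    | succ j ih => rw [add_right_comm, hvt1, ih, hlper, ← hvt1]
  refine ⟨m, fun j => dartAt (vt j) (l j), ⟨hm, fun k => ?_, fun k => ?_, fun k hk => ?_⟩, ?_⟩
  · simp only [hvtper, hlper]
  · rw [finish_eq]; simp [hvt1]
  · have h1 : l (k + 1) = (l k).inv := by
      have := congrArg dartLetter hk
      simpa [dartLetter, dartAt, Letter.inv] using this
    have hred := ht.reduced
    unfold FreeGroup.IsReduced at hred
    rw [List.isChain_iff_getElem] at hred
    have hk1 := Nat.mod_lt k hm
    have hk2 : k % m < w.length := hk1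
    -- Consecutive letters of the periodic word are consecutive in `w ++ w`; the wrap-around is the
    -- junction of the two copies.
    have h2 := hred (k % m) (by simp; omega)
    rw [Letter.compat_iff] at h2
    apply h2
    rw [List.getElem_append_left hk2]
    refine Eq.trans ?_ h1
    by_cases h3 : k % m + 1 < m
    · have h4 : k % m + 1 < w.length := h3
      rw [List.getElem_append_left h4]
      simp only [hl]
      congr 1
      rw [Nat.add_mod, Nat.mod_eq_of_lt (show 1 < m by omega), Nat.mod_eq_of_lt h3]
    · have h4 : k % m + 1 = m := by omega
      have h5 : w.length ≤ k % m + 1 := h4.ge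
      rw [List.getElem_append_right h5]
      simp only [hl]
      congr 1
      have : (k + 1) % m = 0 := by
        rw [← Nat.mod_add_mod, h4, Nat.mod_self]
      omega
  · simp [hl, hvt, hw]

theorem vertexInCore_iff {v : (coveringGraph H).V} :
    (coveringGraph H).VertexInCore v ↔ ∃ y, InCore v y := by
  constructor
  · rintro ⟨m, d, h, k, rfl⟩
    exact ⟨_, inCore_of_isLoop h k⟩
  · rintro ⟨y, hy⟩
    obtain ⟨m, d, h, h0⟩ := exists_isLoop_of_inCore hy
    exact ⟨m, d, h, 0, by rw [h0, start_dartAt]⟩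

theorem edgeInCore_iff {e : (coveringGraph H).E} :
    (coveringGraph H).EdgeInCore e ↔ InCore ((coveringGraph H).src e) (e.2, true) := by
  constructor
  · rintro ⟨m, d, h, k, rfl⟩
    have h1 := inCore_of_isLoop h k
    rcases hb : (d k).2 with _ | _
    · have h2 := h1.inv
      rw [← finish_eq] at h2
      simpa [RoseGraph.finish, hb, dartLetter, Letter.inv] using h2
    · simpa [RoseGraph.start, hb, dartLetter] using h1
  · intro hy
    obtain ⟨m, d, h, h0⟩ := exists_isLoop_of_inCore hy
    refine ⟨m, d, h, 0, ?_⟩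
    rw [h0]
    rfl

theorem mem_letters_iff {v : (coreGraph H).V} {y : Letter n} :
    y ∈ (coreGraph H).letters v ↔ InCore v.1 y := by
  constructor
  · rintro ⟨e, he, hv⟩
    have h1 := edgeInCore_iff.1 e.2
    have h2 : v.1 = (coveringGraph H).start (e.1, y.2) := by
      rw [← hv]
      rcases y with ⟨i, _ | _⟩ <;> rfl
    rcases y with ⟨i, _ | _⟩
    · have h3 : e.1.2 = i := he
      subst h3
      rw [h2]
      exact h1.inv
    · have h3 : e.1.2 = i := he
      subst h3
      rw [h2]
      exact h1
  · intro h
    have h1 : (coveringGraph H).EdgeInCore (dartAt v.1 y).1 := by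
      obtain ⟨m, d, hd, h0⟩ := exists_isLoop_of_inCore h
      exact ⟨m, d, hd, 0, by rw [h0]⟩
    refine ⟨⟨(dartAt v.1 y).1, h1⟩, rfl, ?_⟩
    apply Subtype.ext
    have h2 := start_dartAt v.1 y
    rcases y with ⟨i, _ | _⟩
    · exact h2
    · exact h2

theorem exists_inCore (v : (coreGraph H).V) : ∃ y, InCore v.1 y := vertexInCore_iff.1 v.2

theorem exists_mem_letters_ne (v : (coreGraph H).V) (y : Letter n) :
    ∃ z ∈ (coreGraph H).letters v, z ≠ y := by
  obtain ⟨x, hx⟩ := exists_inCore v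
  by_cases h : x = y
  · obtain ⟨z, hz, hz'⟩ := hx.exists_ne
    exact ⟨z, mem_letters_iff.2 hz', h ▸ hz⟩
  · exact ⟨x, mem_letters_iff.2 hx, h⟩

/-- The vertex of the core at the start of an edge in the core. -/
def InCore.vertex {v : (coveringGraph H).V} {y : Letter n} (h : InCore v y) : (coreGraph H).V :=
  ⟨v, vertexInCore_iff.2 ⟨y, h⟩⟩

/-- The edge of the core with a given initial vertex and label. -/
def InCore.edge {v : (coveringGraph H).V} {i : Fin n} (h : InCore v (i, true)) : (coreGraph H).E :=
  ⟨(v, i), edgeInCore_iff.2 h⟩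

end Translation

/-! ### Finiteness of the core of a finitely generated subgroup. -/

section Finite
variable {n : ℕ} {H : Subgroup (FreeGroup (Fin n))}

theorem exists_finite_reads (v : (coveringGraph H).V) (w : List (Letter n)) :
    ∃ T : Set ((coveringGraph H).V × Letter n), T.Finite ∧ Reads (fun u y => (u, y) ∈ T) v w := by
  induction w generalizing v with
  | nil => exact ⟨∅, Set.finite_empty, trivial⟩
  | cons y w ih =>
    obtain ⟨T, hT, h⟩ := ih (v ◃ FreeGroup.mk [y])
    exact ⟨insert (v, y) T, hT.insert _, Set.mem_insert _ _,
      h.mono fun _ _ hy => Set.mem_insert_of_mem _ hy⟩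

theorem act_cosetMk_one {g : FreeGroup (Fin n)} :
    cosetMk H 1 ◃ g = cosetMk H 1 ↔ g ∈ H := by
  rw [cosetMk_act, cosetMk_eq]
  simp

/-- The core of a finitely generated subgroup is finite. -/
theorem finite_inCore (hH : H.FG) :
    {d : (coveringGraph H).V × Letter n | InCore d.1 d.2}.Finite := by
  obtain ⟨S, hS⟩ := hH
  choose T hT hr using fun g : FreeGroup (Fin n) =>
    exists_finite_reads (cosetMk H 1) g.toWord
  set U : Set ((coveringGraph H).V × Letter n) := ⋃ s ∈ S, T s with hU
  have hUf : U.Finite := S.finite_toSet.biUnion fun s _ => hT s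
  set ι : (coveringGraph H).V × Letter n → (coveringGraph H).V × Letter n :=
    fun d => (d.1 ◃ FreeGroup.mk [d.2], d.2.inv) with hι
  -- The finitely many edges crossed by the generators, in both directions, so that inverses of
  -- elements of `H` also stay in `D`.
  set D : (coveringGraph H).V → Letter n → Prop := fun v y => (v, y) ∈ U ∪ ι '' U with hDdef
  have hD : ∀ v y, D v y → D (v ◃ FreeGroup.mk [y]) y.inv := by
    rintro v y (h | ⟨⟨u, z⟩, h, he⟩)
    · exact Or.inr ⟨_, h, rfl⟩
    · left
      simp only [hι, Prod.mk.injEq] at he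
      rw [← he.1, ← he.2]
      simpa using h
  refine (hUf.union (hUf.image ι)).subset fun d hd => ?_
  refine inCore_le (D := D) (cosetMk H 1) (fun g hg => ?_) d.1 d.2 hd
  rw [act_cosetMk_one, ← hS] at hg
  induction hg using Subgroup.closure_induction with
  | mem s hs => exact (hr s).mono fun v y h => Or.inl (Set.mem_biUnion hs h)
  | one => rw [toWord_one]; trivial
  | mul x y hx hy ihx ihy =>
    rw [hS] at hx
    rw [toWord_mul]
    apply reads_reduce
    rw [reads_append, mk_toWord, act_cosetMk_one.2 hx]
    exact ⟨ihx, ihy⟩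
  | inv x hx ihx =>
    rw [hS] at hx
    rw [toWord_inv]
    have := reads_invRev hD ihx
    rwa [mk_toWord, act_cosetMk_one.2 hx] at this

theorem finite_coreGraph_V (hH : H.FG) : Finite (coreGraph H).V := by
  have := (finite_inCore hH).to_subtype
  choose f hf using fun v : (coreGraph H).V => exists_inCore v
  exact Finite.of_injective
    (fun v => (⟨(v.1, f v), hf v⟩ : {d : (coveringGraph H).V × Letter n | InCore d.1 d.2}))
    fun u v h => Subtype.ext (congrArg (fun d => d.1.1) h)

theorem finite_coreGraph_E (hH : H.FG) : Finite (coreGraph H).E := by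
  have := (finite_inCore hH).to_subtype
  refine Finite.of_injective
    (fun e => (⟨(e.1.1, (e.1.2, true)), edgeInCore_iff.1 e.2⟩ :
      {d : (coveringGraph H).V × Letter n | InCore d.1 d.2})) fun e e' h => Subtype.ext ?_
  exact Prod.ext (congrArg (fun d => d.1.1) h) (congrArg (fun d => d.1.2.1) h)

end Finite

/-! ### The effect of a Whitehead automorphism on the core. -/

theorem natCard_lt_of_injective_of_ne {α β : Type*} [Finite β] (f : α → β)
    (hf : Function.Injective f) (b : β) (hb : ∀ x, f x ≠ b) : ENat.card α < ENat.card β := by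
  have : Finite α := Finite.of_injective f hf
  rw [ENat.card_eq_coe_natCard, ENat.card_eq_coe_natCard, Nat.cast_lt]
  have := Fintype.ofFinite α
  have := Fintype.ofFinite β
  rw [Nat.card_eq_fintype_card, Nat.card_eq_fintype_card]
  exact Fintype.card_lt_of_injective_of_notMem f hf (b := b) (by rintro ⟨x, hx⟩; exact hb x hx)

namespace WhiteheadPair
variable {n : ℕ} (P : WhiteheadPair n) {H : Subgroup (FreeGroup (Fin n))}

theorem toAut_mk_a : P.toAut (FreeGroup.mk [P.a]) = FreeGroup.mk [P.a] := by
  rw [Letter.mk_singleton]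
  exact P.toHom_a

open Classical in
theorem toAut_mk_letter {y : Letter n} (h₁ : y ≠ P.a) (h₂ : y ≠ P.a.inv) :
    P.toAut (FreeGroup.mk [y]) = (if y ∈ P.A then FreeGroup.mk [P.a] else 1) *
      FreeGroup.mk [y] * (if y.inv ∈ P.A then FreeGroup.mk [P.a] else 1)⁻¹ := by
  have hne : y.1 ≠ P.a.1 := by
    intro h
    rcases hP : P.a with ⟨i, b⟩
    rcases y with ⟨j, c⟩
    rw [hP] at h h₁ h₂
    cases b <;> cases c <;> simp_all [Letter.inv]
  change P.toHom (FreeGroup.mk [y]) = _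
  rcases y with ⟨j, _ | _⟩
  · rw [mk_false, _root_.map_inv, toHom_of, if_neg hne, Letter.mk_singleton]
    simp only [Letter.inv, Bool.not_false]
    split_ifs <;> simp [mul_assoc]
  · rw [mk_true, toHom_of, if_neg hne, Letter.mk_singleton]
    simp only [Letter.inv, Bool.not_true]
    split_ifs <;> simp [mul_assoc]

/-- The bijection between the cosets of `H` and of its image. -/
def cosetMap (v : (coveringGraph H).V) : (coveringGraph (H.map P.toAut.toMonoidHom)).V :=
  Quotient.map (sb := QuotientGroup.rightRel (H.map P.toAut.toMonoidHom)) P.toAut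
    (fun u v (h : QuotientGroup.rightRel H u v) => by
      change QuotientGroup.rightRel _ _ _
      rw [QuotientGroup.rightRel_apply] at h ⊢
      exact ⟨_, h, by simp⟩) v

theorem cosetMap_act (v : (coveringGraph H).V) (g : FreeGroup (Fin n)) :
    P.cosetMap (v ◃ g) = P.cosetMap v ◃ P.toAut g := by
  obtain ⟨w, rfl⟩ := cosetMk_surjective v
  change cosetMk (H.map P.toAut.toMonoidHom) (P.toAut (w * g)) =
    cosetMk (H.map P.toAut.toMonoidHom) (P.toAut w) ◃ P.toAut g
  rw [cosetMk_act, _root_.map_mul]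

theorem cosetMap_injective : Function.Injective (P.cosetMap (H := H)) := by
  intro u v h
  obtain ⟨u, rfl⟩ := cosetMk_surjective u
  obtain ⟨v, rfl⟩ := cosetMk_surjective v
  have h1 : cosetMk (H.map P.toAut.toMonoidHom) (P.toAut u) = cosetMk _ (P.toAut v) := h
  rw [cosetMk_eq] at h1 ⊢
  obtain ⟨x, hx, hxe⟩ := h1
  have : P.toAut x = P.toAut (v * u⁻¹) := by simpa using hxe
  rwa [← P.toAut.injective this]

/-- Some letter of `A` is a letter of the core at the vertex. -/
def Meets (v : (coveringGraph H).V) : Prop := ∃ y ∈ P.A, InCore v y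

open Classical in
/-- The translation of a vertex of the core under the automorphism. -/
noncomputable def shift (v : (coveringGraph H).V) : FreeGroup (Fin n) :=
  if P.Meets v then FreeGroup.mk [P.a] else 1

theorem toAut_shift (v : (coveringGraph H).V) : P.toAut (P.shift v) = P.shift v := by
  unfold shift
  split_ifs
  · exact P.toAut_mk_a
  · simp

/-- The map from the vertices of the core of `H` to the vertices of the covering graph of the
image of `H`. -/
noncomputable def vertexMap (v : (coveringGraph H).V) :
    (coveringGraph (H.map P.toAut.toMonoidHom)).V :=
  P.cosetMap v ◃ P.shift v

theorem vertexMap_act (v : (coveringGraph H).V) (g : FreeGroup (Fin n)) :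
    P.vertexMap v ◃ ((P.shift v)⁻¹ * P.toAut g * P.shift (v ◃ g)) = P.vertexMap (v ◃ g) := by
  rw [vertexMap, vertexMap, cosetMap_act, act_act, act_act]
  group

/-- At each vertex of the core of `H` the letters either avoid `A`, or lie in `A` except
possibly for `a`. -/
def Splits (H : Subgroup (FreeGroup (Fin n))) : Prop :=
  ∀ (v : (coveringGraph H).V) (y z : Letter n), y ∈ P.A → InCore v y → InCore v z →
    z ∈ P.A ∨ z = P.a

/-- The directed edges of the image of the core of `H`, after collapsing the edges which the
automorphism removes. -/
inductive ImageDart (H : Subgroup (FreeGroup (Fin n))) :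
    (coveringGraph (H.map P.toAut.toMonoidHom)).V → Letter n → Prop
  | of {u : (coveringGraph H).V} {y : Letter n} (h : InCore u y) (h₁ : y ≠ P.a)
      (h₂ : y ≠ P.a.inv) : ImageDart H (P.vertexMap u) y
  | pos {u : (coveringGraph H).V} (h : InCore u P.a) (h₁ : ¬ P.Meets u) :
      ImageDart H (P.vertexMap u) P.a
  | neg {u : (coveringGraph H).V} (h : InCore u P.a) (h₁ : ¬ P.Meets u) :
      ImageDart H (P.vertexMap (u ◃ FreeGroup.mk [P.a])) P.a.inv

variable {P}

/-- Any single letter other than `a` decides whether a vertex is moved, so the shift at both ends of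
an edge can be read off its own label. -/
theorem Splits.meets_iff (hP : P.Splits H) {v : (coveringGraph H).V} {y : Letter n}
    (hy : InCore v y) (hya : y ≠ P.a) : P.Meets v ↔ y ∈ P.A :=
  ⟨fun ⟨_, hz, hvz⟩ => (hP v _ y hz hvz hy).resolve_right hya, fun h => ⟨y, h, hy⟩⟩

theorem Splits.not_meets_act (hP : P.Splits H) {v : (coveringGraph H).V} (h : InCore v P.a) :
    ¬ P.Meets (v ◃ FreeGroup.mk [P.a]) := by
  rw [hP.meets_iff h.inv (Letter.inv_ne _)]
  exact P.inv_notMem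

/-- The shifts at the two ends cancel the factors `a` that the automorphism puts around a letter. An
`a`-edge never ends at a moved vertex: it becomes trivial if it starts at one and is kept otherwise.
-/
theorem Splits.reads_letter (hP : P.Splits H) {u : (coveringGraph H).V} {y : Letter n}
    (h : InCore u y) : ∃ s, Reads (P.ImageDart H) (P.vertexMap u) s ∧
      FreeGroup.mk s =
        (P.shift u)⁻¹ * P.toAut (FreeGroup.mk [y]) * P.shift (u ◃ FreeGroup.mk [y]) := by
  by_cases h₁ : y = P.a
  · subst h₁
    have h3 := hP.not_meets_act h
    by_cases h2 : P.Meets u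
    · refine ⟨[], trivial, ?_⟩
      rw [shift, if_pos h2, shift, if_neg h3, toAut_mk_a, ← FreeGroup.one_eq_mk]
      group
    · refine ⟨[P.a], ⟨.pos h h2, trivial⟩, ?_⟩
      rw [shift, if_neg h2, shift, if_neg h3, toAut_mk_a]
      simp
  by_cases h₂ : y = P.a.inv
  · subst h₂
    have h' : InCore (u ◃ FreeGroup.mk [P.a.inv]) P.a := by simpa using h.inv
    have hu : u ◃ FreeGroup.mk [P.a.inv] ◃ FreeGroup.mk [P.a] = u := act_inv_letter _ _
    have h3 := hP.not_meets_act h'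
    rw [hu] at h3
    by_cases h2 : P.Meets (u ◃ FreeGroup.mk [P.a.inv])
    · refine ⟨[], trivial, ?_⟩
      rw [shift, if_neg h3, shift, if_pos h2, Letter.mk_inv, _root_.map_inv, toAut_mk_a,
        ← FreeGroup.one_eq_mk]
      group
    · refine ⟨[P.a.inv], ⟨?_, trivial⟩, ?_⟩
      · have := ImageDart.neg h' h2
        rwa [hu] at this
      · rw [shift, if_neg h3, shift, if_neg h2, Letter.mk_inv, _root_.map_inv, toAut_mk_a]
        simp
  · refine ⟨[y], ⟨.of h h₁ h₂, trivial⟩, ?_⟩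
    have h4 : y.inv ≠ P.a := fun h5 => h₂ (by rw [← h5, Letter.inv_inv])
    rw [toAut_mk_letter P h₁ h₂]
    simp only [shift, hP.meets_iff h h₁, hP.meets_iff h.inv h4]
    group

theorem Splits.reads_word (hP : P.Splits H) {u : (coveringGraph H).V} {w : List (Letter n)}
    (h : Reads InCore u w) : ∃ s, Reads (P.ImageDart H) (P.vertexMap u) s ∧
      FreeGroup.mk s =
        (P.shift u)⁻¹ * P.toAut (FreeGroup.mk w) * P.shift (u ◃ FreeGroup.mk w) := by
  induction w generalizing u with
  | nil => exact ⟨[], trivial, by simp [← FreeGroup.one_eq_mk]⟩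
  | cons y w ih =>
    obtain ⟨s, hs, hse⟩ := hP.reads_letter h.1
    obtain ⟨t, ht, hte⟩ := ih h.2
    refine ⟨s ++ t, ?_, ?_⟩
    · rw [reads_append, hse, vertexMap_act]
      exact ⟨hs, ht⟩
    · rw [← FreeGroup.mul_mk, hse, hte, act_mk_cons u y w,
        show FreeGroup.mk (y :: w) = FreeGroup.mk [y] * FreeGroup.mk w from
          (FreeGroup.mul_mk (L₁ := [y])).symm, _root_.map_mul]
      group

/-- By `inCore_le` it suffices to treat closed paths at the image of `u₀`. Such a path pulls back to
a reduced closed path at `u₀`, which stays in the core by `reads_inCore`; its image, after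
reduction, is the given path. -/
theorem Splits.imageDart_of_inCore (hP : P.Splits H) {u₀ : (coveringGraph H).V} {y₀ : Letter n}
    (h₀ : InCore u₀ y₀) {v : (coveringGraph (H.map P.toAut.toMonoidHom)).V} {y : Letter n}
    (hv : InCore v y) : P.ImageDart H v y := by
  refine inCore_le (P.vertexMap u₀) (fun g hg => ?_) v y hv
  set h := P.shift u₀ * P.toAut.symm g * (P.shift u₀)⁻¹ with hh
  have hφ : P.toAut h = P.shift u₀ * g * (P.shift u₀)⁻¹ := by
    simp [hh, toAut_shift]
  have hu : u₀ ◃ h = u₀ := by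
    apply P.cosetMap_injective
    rw [cosetMap_act, hφ, ← act_act, ← act_act]
    change P.vertexMap u₀ ◃ g ◃ _ = _
    rw [hg, vertexMap, act_act, mul_inv_cancel, act_one]
  have hr := reads_inCore (p := h.toWord) h₀ h₀ isReduced_toWord (by rw [mk_toWord, hu])
  obtain ⟨s, hs, hse⟩ := hP.reads_word hr
  rw [mk_toWord, hu, hφ] at hse
  have : FreeGroup.mk s = g := by rw [hse]; group
  rw [← this]
  exact reads_toWord_of_mk hs

/-- The vertices and edges of the new core have preimages in the old one that avoid `u₀` and the
collapsed `a`-edge at `u₀`. Choosing such preimages is injective and misses an element. -/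
theorem Splits.strictlyReduces (hP : P.Splits H) (hH : H.FG) {u₀ : (coveringGraph H).V}
    (h₀ : P.Meets u₀) (ha : InCore u₀ P.a) : StrictlyReduces P H := by
  have := finite_coreGraph_V hH
  have := finite_coreGraph_E hH
  constructor
  · have key : ∀ v : (coreGraph (H.map P.toAut.toMonoidHom)).V,
        ∃ u : (coreGraph H).V, P.vertexMap u.1 = v.1 ∧ u ≠ ha.vertex := by
      intro v
      obtain ⟨y, hy⟩ := exists_inCore v
      have hD := hP.imageDart_of_inCore ha hy
      generalize v.1 = v' at hD
      have aux : ∀ (u : (coveringGraph H).V) (y : Letter n) (hu : InCore u y) (h : ¬ P.Meets u),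
          ∃ w : (coreGraph H).V, P.vertexMap w.1 = P.vertexMap u ∧ w ≠ ha.vertex :=
        fun u y hu h => ⟨hu.vertex, rfl, fun he => h (by
            rwa [show u = u₀ from congrArg Subtype.val he])⟩
      have aux' : ∀ (u : (coveringGraph H).V) (hu : InCore u P.a),
          ∃ w : (coreGraph H).V, P.vertexMap w.1 = P.vertexMap (u ◃ FreeGroup.mk [P.a]) ∧
            w ≠ ha.vertex := fun u hu => aux _ _ hu.inv (hP.not_meets_act hu)
      cases hD with
      | @of u y h h₁ h₂ =>
        by_cases hu : u = u₀
        · subst hu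
          -- The shift by `a` at `u₀` is exactly the collapsed edge, so its far end is a preimage
          -- that can replace `u₀`.
          have : P.vertexMap u = P.vertexMap (u ◃ FreeGroup.mk [P.a]) := by
            rw [vertexMap, shift, if_pos h₀, vertexMap, shift, if_neg (hP.not_meets_act ha),
              act_one, cosetMap_act, toAut_mk_a]
          rw [this]
          exact aux' u ha
        · exact ⟨h.vertex, rfl, fun he => hu (congrArg Subtype.val he)⟩
      | pos h h₁ => exact aux _ _ h h₁
      | neg h h₁ => exact aux' _ h
    choose f hf hf' using key
    exact natCard_lt_of_injective_of_ne f
      (fun v w h => Subtype.ext (by rw [← hf, ← hf, h])) _ hf'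
  · have he₀ : (coveringGraph H).EdgeInCore (dartAt u₀ P.a).1 := by
      obtain ⟨m, d, hd, h0⟩ := exists_isLoop_of_inCore ha
      exact ⟨m, d, hd, 0, by rw [h0]⟩
    have key : ∀ e : (coreGraph (H.map P.toAut.toMonoidHom)).E,
        ∃ e' : (coreGraph H).E, P.vertexMap e'.1.1 = e.1.1 ∧ e'.1.2 = e.1.2 ∧
          e' ≠ ⟨_, he₀⟩ := by
      intro e
      have hD := hP.imageDart_of_inCore ha (edgeInCore_iff.1 e.2)
      rcases e with ⟨⟨v, i⟩, hvi⟩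
      change ImageDart P H v (i, true) at hD
      change ∃ e' : (coreGraph H).E, P.vertexMap e'.1.1 = v ∧ e'.1.2 = i ∧ e' ≠ ⟨_, he₀⟩
      generalize hy : (i, true) = y at hD
      cases hD with
      | @of u y h h₁ h₂ =>
        subst hy
        refine ⟨h.edge, rfl, rfl, fun he => ?_⟩
        have h3 : i = P.a.1 := congrArg (fun e => e.1.2) he
        rcases hP : P.a with ⟨j, b⟩
        rw [hP] at h₁ h₂ h3
        subst h3
        cases b <;> simp [Letter.inv] at h₁ h₂
      | @pos u h h₁ =>
        have h' : InCore u (i, true) := hy ▸ h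
        refine ⟨h'.edge, rfl, rfl, fun he => ?_⟩
        have h3 : u = (dartAt u₀ P.a).1.1 := congrArg (fun e => e.1.1) he
        rw [← hy] at h3
        exact h₁ (h3 ▸ h₀)
      | @neg u h h₁ =>
        have h' : InCore (u ◃ FreeGroup.mk [P.a]) (i, true) := hy ▸ h.inv
        refine ⟨h'.edge, rfl, rfl, fun he => ?_⟩
        have h3 : u ◃ FreeGroup.mk [P.a] = (dartAt u₀ P.a).1.1 := congrArg (fun e => e.1.1) he
        -- Here `a` is an inverse generator, so the oriented edge starts where crossing along `a`
        -- ends.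
        have h4 : P.a = (i, false) := by
          rw [← Letter.inv_inv P.a, ← hy]; rfl
        rw [h4] at h3
        exact h₁ (act_right_cancel h3 ▸ h₀)
    choose f hf hf' hf'' using key
    refine natCard_lt_of_injective_of_ne f (fun v w h => Subtype.ext (Prod.ext ?_ ?_)) _ hf''
    · rw [← hf, ← hf, h]
    · rw [← hf', ← hf', h]

end WhiteheadPair

/-! ### From a cut vertex to a reducing automorphism. -/

/-- Remove `a` from its component and take a piece without the inverse of `a`, or all that is left
if the inverse lies elsewhere. The final clause provides a vertex of the core at which an edge will
collapse. -/
theorem IsCutVertex.exists_set {n : ℕ} {W : SimpleGraph (Letter n)} {a : Letter n}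
    (h : IsCutVertex W a) : ∃ A : Set (Letter n), a ∉ A ∧ a.inv ∉ A ∧
      (∀ y ∈ A, ∀ z, W.Adj y z → z ∈ A ∨ z = a) ∧ ∃ y ∈ A, W.Adj a y := by
  obtain ⟨⟨y₀, hy₀⟩, h⟩ := h
  by_cases h1 : W.Reachable a a.inv
  · have h2 := h.resolve_left (not_not.2 h1)
    set S : Set (Letter n) := {y | W.Reachable a y ∧ y ≠ a} with hS
    have hne : Nonempty S := ⟨⟨y₀, hy₀.reachable, hy₀.ne'⟩⟩
    have h3 : ¬ (W.induce S).Preconnected := fun hp => h2 ⟨hp⟩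
    have h4 : ∃ r : S, ∀ h : a.inv ∈ S, ¬ (W.induce S).Reachable r ⟨a.inv, h⟩ := by
      by_contra! hc
      refine h3 fun p q => ?_
      obtain ⟨h, hp⟩ := hc p
      obtain ⟨h', hq⟩ := hc q
      exact hp.trans hq.symm
    obtain ⟨r, hr⟩ := h4
    set A : Set (Letter n) := {y | ∃ h : y ∈ S, (W.induce S).Reachable r ⟨y, h⟩} with hA
    have haA : a ∉ A := fun ⟨h, _⟩ => h.2 rfl
    have hcl : ∀ y ∈ A, ∀ z, W.Adj y z → z ∈ A ∨ z = a := by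
      rintro y ⟨hy, hry⟩ z hz
      by_cases hza : z = a
      · exact Or.inr hza
      · have hzS : z ∈ S := ⟨hy.1.trans hz.reachable, hza⟩
        refine Or.inl ⟨hzS, hry.trans (SimpleGraph.Adj.reachable ?_)⟩
        exact hz
    refine ⟨A, haA, fun ⟨h, hi⟩ => hr h hi, hcl, ?_⟩
    -- A walk from `r` to `a` must leave `A`, and it can leave only to `a`.
    obtain ⟨p⟩ := r.2.1.symm
    obtain ⟨d, -, hd1, hd2⟩ := p.exists_boundary_dart A ⟨r.2, .rfl⟩ haA
    have h5 := (hcl _ hd1 _ d.adj).resolve_left hd2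
    exact ⟨d.fst, hd1, by rw [← h5]; exact d.adj.symm⟩
  · refine ⟨{y | W.Reachable a y ∧ y ≠ a}, fun h => h.2 rfl, fun h => h1 h.1, ?_,
      y₀, ⟨hy₀.reachable, hy₀.ne'⟩, hy₀⟩
    rintro y ⟨hy, -⟩ z hz
    by_cases hza : z = a
    · exact Or.inr hza
    · exact Or.inl ⟨hy.trans hz.reachable, hza⟩

/-- A cut vertex of the Whitehead graph provides a Whitehead automorphism which reduces
the core graph. -/
theorem exists_strictlyReduces_of_isCutVertex {n : ℕ} {H : Subgroup (FreeGroup (Fin n))}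
    (hH : H.FG) {a : Letter n} (h : IsCutVertex (coreGraph H).whiteheadGraph a) :
    ∃ P : WhiteheadPair n, StrictlyReduces P H ∧
      ∀ v : (coreGraph H).V, Trichotomy P (coreGraph H) v := by
  classical
  obtain ⟨A, haA, hinv, hcl, y, hyA, -, v, hav, hyv⟩ := h.exists_set
  let P : WhiteheadPair n := ⟨a, A.toFinset, by simpa using haA, by simpa using hinv⟩
  have hPA : ∀ z, z ∈ P.A ↔ z ∈ A := fun z => Set.mem_toFinset
  have hsub : ∀ (v : (coreGraph H).V), ∀ y ∈ (coreGraph H).letters v, y ∈ A →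
      ∀ z ∈ (coreGraph H).letters v, z ∈ A ∨ z = a := by
    intro v y hy hyA z hz
    by_cases hyz : y = z
    · exact Or.inl (hyz ▸ hyA)
    · exact hcl y hyA z ⟨hyz, v, hy, hz⟩
  have hP : P.Splits H := by
    intro v y z hyA hy hz
    rw [hPA] at hyA ⊢
    exact hsub hy.vertex y (mem_letters_iff.2 hy) hyA z (mem_letters_iff.2 hz)
  refine ⟨P, hP.strictlyReduces hH (u₀ := v.1) ⟨y, (hPA y).2 hyA, mem_letters_iff.1 hyv⟩
    (mem_letters_iff.1 hav), fun v => ?_⟩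
  have hcoe : (P.A : Set (Letter n)) = A := Set.coe_toFinset A
  have hPa : P.a = a := rfl
  -- A letter other than `a` at `v` is what separates the first alternative from the other two.
  obtain ⟨x, hx, hxa⟩ := exists_mem_letters_ne v a
  unfold Trichotomy ExactlyOne
  rw [hcoe, hPa]
  refine ⟨?_, ?_, ?_, ?_⟩
  · by_cases h1 : (coreGraph H).letters v ∩ A = ∅
    · exact Or.inl h1
    · obtain ⟨y, hy, hyA⟩ := Set.nonempty_iff_ne_empty.2 h1
      have h2 := hsub v y hy hyA
      by_cases h3 : a ∈ (coreGraph H).letters v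
      · exact Or.inr (Or.inr ⟨h3, h2⟩)
      · exact Or.inr (Or.inl fun z hz => (h2 z hz).resolve_right fun h => h3 (h ▸ hz))
  · rintro ⟨h1, h2⟩
    exact Set.eq_empty_iff_forall_notMem.1 h1 x ⟨hx, h2 hx⟩
  · rintro ⟨h1, -, h2⟩
    exact Set.eq_empty_iff_forall_notMem.1 h1 x ⟨hx, (h2 hx).resolve_right hxa⟩
  · rintro ⟨h1, h2, -⟩
    exact haA (h1 h2)

/-! ### Full graphs, Euler characteristic and folding. -/

namespace RoseGraph
variable {n : ℕ}

/-- Some edge path from `u` to `v` reads the element `g`. -/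
inductive Linked (G : RoseGraph n) (u : G.V) : G.V → FreeGroup (Fin n) → Prop
  | refl : Linked G u u 1
  | step {g : FreeGroup (Fin n)} (d : G.Dart) (h : Linked G u (G.start d) g) :
      Linked G u (G.finish d) (g * FreeGroup.mk [(G.label d.1, d.2)])

/-- Each element of the free group can be read between each two vertices: the graph is connected
and its fundamental group maps onto the free group. -/
def Full (G : RoseGraph n) : Prop := ∀ u v g, G.Linked u v g

theorem Linked.trans {G : RoseGraph n} {u v w : G.V} {g h : FreeGroup (Fin n)}
    (h₁ : G.Linked u v g) (h₂ : G.Linked v w h) : G.Linked u w (g * h) := by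
  induction h₂ with
  | refl => simpa using h₁
  | step d _ ih => rw [← mul_assoc]; exact .step d ih

theorem linked_dart (G : RoseGraph n) (d : G.Dart) :
    G.Linked (G.start d) (G.finish d) (FreeGroup.mk [(G.label d.1, d.2)]) := by
  have := Linked.step d (.refl (G := G) (u := G.start d))
  rwa [one_mul] at this

theorem linked_dart_inv (G : RoseGraph n) (d : G.Dart) :
    G.Linked (G.finish d) (G.start d) (FreeGroup.mk [(G.label d.1, d.2)])⁻¹ := by
  have := G.linked_dart (d.1, !d.2)
  rw [← Letter.mk_inv]
  rcases d with ⟨e, _ | _⟩ <;> exact this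

theorem Linked.symm {G : RoseGraph n} {u v : G.V} {g : FreeGroup (Fin n)}
    (h : G.Linked u v g) : G.Linked v u g⁻¹ := by
  induction h with
  | refl => simpa using Linked.refl
  | step d _ ih => rw [mul_inv_rev]; exact (G.linked_dart_inv d).trans ih

/-- A label preserving morphism of graphs. -/
structure Hom (G G' : RoseGraph n) where
  /-- the map on vertices -/
  onV : G.V → G'.V
  /-- the map on edges -/
  onE : G.E → G'.E
  src_onE : ∀ e, G'.src (onE e) = onV (G.src e)
  tgt_onE : ∀ e, G'.tgt (onE e) = onV (G.tgt e)
  label_onE : ∀ e, G'.label (onE e) = G.label e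

namespace Hom
variable {G G' G'' : RoseGraph n}

/-- The composition of two morphisms. -/
def comp (ψ : Hom G' G'') (φ : Hom G G') : Hom G G'' where
  onV := ψ.onV ∘ φ.onV
  onE := ψ.onE ∘ φ.onE
  src_onE e := by simp [ψ.src_onE, φ.src_onE]
  tgt_onE e := by simp [ψ.tgt_onE, φ.tgt_onE]
  label_onE e := by simp [ψ.label_onE, φ.label_onE]

theorem start_onE (φ : Hom G G') (e : G.E) (b : Bool) :
    G'.start (φ.onE e, b) = φ.onV (G.start (e, b)) := by
  cases b <;> simp [start, φ.src_onE, φ.tgt_onE]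

theorem finish_onE (φ : Hom G G') (e : G.E) (b : Bool) :
    G'.finish (φ.onE e, b) = φ.onV (G.finish (e, b)) := by
  cases b <;> simp [finish, φ.src_onE, φ.tgt_onE]

theorem linked (φ : Hom G G') {u v : G.V} {g : FreeGroup (Fin n)} (h : G.Linked u v g) :
    G'.Linked (φ.onV u) (φ.onV v) g := by
  induction h with
  | refl => exact .refl
  | step d _ ih =>
    rcases d with ⟨e, b⟩
    rw [← φ.start_onE] at ih
    have := ih.step
    rwa [φ.finish_onE, φ.label_onE] at this

theorem full (φ : Hom G G') (hφ : Function.Surjective φ.onV) (h : G.Full) : G'.Full := by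
  intro u v g
  obtain ⟨u, rfl⟩ := hφ u
  obtain ⟨v, rfl⟩ := hφ v
  exact φ.linked (h u v g)

end Hom

/-- Dimension count for `(f, l) ↦ δf - l ∘ label`. For a pair in the kernel, the change of `f` along
a path is the value of `l` on the word read. Reading `1` between any two vertices makes `f`
constant, and reading each generator along a closed path gives `l = 0`; so the kernel is at most a
line. -/
theorem Full.card_le {G : RoseGraph n} [Finite G.V] [Finite G.E] [Nonempty G.V] (hG : G.Full) :
    Nat.card G.V + n ≤ Nat.card G.E + 1 := by
  have := Fintype.ofFinite G.V
  have := Fintype.ofFinite G.E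
  let Φ : ((G.V → ℚ) × (Fin n → ℚ)) →ₗ[ℚ] (G.E → ℚ) :=
    { toFun := fun p e => p.1 (G.tgt e) - p.1 (G.src e) - p.2 (G.label e)
      map_add' := fun p q => by ext e; simp; ring
      map_smul' := fun c p => by ext e; simp; ring }
  have hker : LinearMap.ker Φ ≤ Submodule.span ℚ {((1 : G.V → ℚ), (0 : Fin n → ℚ))} := by
    rintro ⟨f, l⟩ hp
    have hp' : ∀ e, f (G.tgt e) - f (G.src e) - l (G.label e) = 0 := fun e => congrFun hp e
    let Λ : FreeGroup (Fin n) →* Multiplicative ℚ :=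
      FreeGroup.lift fun i => Multiplicative.ofAdd (l i)
    have key : ∀ u v g, G.Linked u v g → f v - f u = (Λ g).toAdd := by
      intro u v g h
      induction h with
      | refl => simp
      | step d _ ih =>
        rcases d with ⟨e, _ | _⟩
        · simp only [start, finish, Bool.false_eq_true, if_false, _root_.map_mul, toAdd_mul, mk_false,
            _root_.map_inv, toAdd_inv, ← ih]
          have h2 := hp' e
          simp only [Λ, FreeGroup.lift_apply_of, toAdd_ofAdd]
          linarith
        · simp only [start, finish, if_true, _root_.map_mul, toAdd_mul, mk_true, ← ih]
          have h2 := hp' e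
          simp only [Λ, FreeGroup.lift_apply_of, toAdd_ofAdd]
          linarith
    obtain ⟨v₀⟩ := ‹Nonempty G.V›
    rw [Submodule.mem_span_singleton]
    refine ⟨f v₀, Prod.ext ?_ ?_⟩
    · ext v
      have := key v₀ v 1 (hG _ _ _)
      simp only [_root_.map_one, toAdd_one] at this
      simp; linarith
    · ext i
      have := key v₀ v₀ (FreeGroup.of i) (hG _ _ _)
      simp only [Λ, FreeGroup.lift_apply_of, toAdd_ofAdd, sub_self] at this
      simpa using this
  have h1 : Module.finrank ℚ (LinearMap.ker Φ) ≤ 1 :=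
    (Submodule.finrank_mono hker).trans (by simpa using finrank_span_le_card (R := ℚ) {((1 : G.V → ℚ), (0 : Fin n → ℚ))})
  have h2 := Φ.finrank_range_add_finrank_ker
  have h3 := (LinearMap.range Φ).finrank_le
  simp only [Module.finrank_prod, Module.finrank_fintype_fun_eq_card, Fintype.card_fin] at h2 h3
  rw [Nat.card_eq_fintype_card, Nat.card_eq_fintype_card]
  omega

/-- No two edges with the same label have a common start or a common end. -/
def Folded (G : RoseGraph n) : Prop :=
  ∀ (e e' : G.E) (b : Bool), G.label e = G.label e' → G.start (e, b) = G.start (e', b) → e = e'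

theorem exists_perm_of_injective {α β : Type*} [Finite α] {s t : β → α}
    (hs : Function.Injective s) (ht : Function.Injective t) :
    ∃ σ : Equiv.Perm α, ∀ x, σ (s x) = t x := by
  classical
  have := Fintype.ofFinite α
  let e : {x // x ∈ Set.range s} ≃ {x // x ∈ Set.range t} :=
    (Equiv.ofInjective s hs).symm.trans (Equiv.ofInjective t ht)
  refine ⟨e.extendSubtype, fun x => ?_⟩
  rw [Equiv.extendSubtype_apply_of_mem e _ ⟨x, rfl⟩]
  simp [e, Equiv.ofInjective_symm_apply]

/-- In a folded graph each label is a partial injection of the finite vertex set and extends to a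
permutation. The free group then acts on the vertices, and a path reading `1` has equal ends. -/
theorem Full.subsingleton_of_folded {G : RoseGraph n} [Finite G.V] (hG : G.Full)
    (hf : G.Folded) : Subsingleton G.V := by
  have hσ : ∀ i : Fin n, ∃ σ : Equiv.Perm G.V, ∀ e : {e // G.label e = i},
      σ (G.src e) = G.tgt e := fun i =>
    exists_perm_of_injective
      (fun e e' h => Subtype.ext (hf e e' true (e.2.trans e'.2.symm) h))
      (fun e e' h => Subtype.ext (hf e e' false (e.2.trans e'.2.symm) h))
  choose σ hσ using hσ
  -- The inverses turn path concatenation, a right action, into a left action carrying the end of a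
  -- path to its start.
  let ρ : FreeGroup (Fin n) →* Equiv.Perm G.V := FreeGroup.lift fun i => (σ i)⁻¹
  have key : ∀ u v g, G.Linked u v g → ρ g v = u := by
    intro u v g h
    induction h with
    | refl => simp
    | step d _ ih =>
      rcases d with ⟨e, _ | _⟩
      · have h2 := hσ _ ⟨e, rfl⟩
        simpa [mk_false, ρ, finish, start, h2] using ih
      · have h2 := hσ _ ⟨e, rfl⟩
        rw [← ih]
        simp [mk_true, ρ, finish, start, ← h2]
  exact ⟨fun u v => by simpa using (key u v 1 (hG u v 1)).symm⟩

/-- The graph obtained by deleting an edge. -/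
def deleteEdge (G : RoseGraph n) (e : G.E) : RoseGraph n where
  V := G.V
  E := {x // x ≠ e}
  src x := G.src x.1
  tgt x := G.tgt x.1
  label x := G.label x.1

theorem card_subtype_ne {α : Type*} [Finite α] (a : α) :
    Nat.card α = Nat.card {x // x ≠ a} + 1 := by
  classical
  rw [← Finite.card_option]
  exact Nat.card_congr (Equiv.optionSubtypeNe a).symm

/-- An edge `e'` which is parallel to another edge `e` can be deleted. -/
theorem exists_collapse_parallel (G : RoseGraph n) [Finite G.V] [Finite G.E] {e e' : G.E}
    (hne : e ≠ e') (hl : G.label e = G.label e') (hs : G.src e = G.src e')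
    (ht : G.tgt e = G.tgt e') :
    ∃ (G' : RoseGraph n) (π : Hom G G'), Function.Surjective π.onV ∧ Finite G'.V ∧ Finite G'.E ∧
      Nat.card G.V = Nat.card G'.V ∧ Nat.card G.E = Nat.card G'.E + 1 ∧
      ∀ x x', π.onE x = π.onE x' → x = x' ∨ (x = e' ∧ x' = e) ∨ (x = e ∧ x' = e') := by
  classical
  let π : Hom G (G.deleteEdge e') :=
    { onV := fun v => v
      onE := fun x => if h : x = e' then ⟨e, hne⟩ else ⟨x, h⟩
      src_onE := fun x => by split_ifs with h <;> simp [deleteEdge, h, hs]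
      tgt_onE := fun x => by split_ifs with h <;> simp [deleteEdge, h, ht]
      label_onE := fun x => by split_ifs with h <;> simp [deleteEdge, h, hl] }
  refine ⟨_, π, Function.surjective_id, ‹Finite G.V›, Subtype.finite, rfl, card_subtype_ne e',
    fun x x' h => ?_⟩
  change (if h : x = e' then (⟨e, hne⟩ : {x // x ≠ e'}) else ⟨x, h⟩) =
    if h : x' = e' then ⟨e, hne⟩ else ⟨x', h⟩ at h
  by_cases h₁ : x = e' <;> by_cases h₂ : x' = e'
  · exact Or.inl (h₁.trans h₂.symm)
  · rw [dif_pos h₁, dif_neg h₂] at h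
    exact Or.inr (Or.inl ⟨h₁, (congrArg Subtype.val h).symm⟩)
  · rw [dif_neg h₁, dif_pos h₂] at h
    exact Or.inr (Or.inr ⟨congrArg Subtype.val h, h₂⟩)
  · rw [dif_neg h₁, dif_neg h₂] at h
    exact Or.inl (congrArg Subtype.val h)

/-- Deleting one of two such edges would leave a full graph with too few edges for `Full.card_le`.
-/
theorem Full.eq_of_parallel {G : RoseGraph n} [Finite G.V] [Finite G.E] (hG : G.Full)
    (hc : Nat.card G.E + 1 ≤ Nat.card G.V + n) {e e' : G.E} (hl : G.label e = G.label e')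
    (hs : G.src e = G.src e') (ht : G.tgt e = G.tgt e') : e = e' := by
  by_contra hne
  obtain ⟨G', π, hπ, _, _, hV, hE, -⟩ := G.exists_collapse_parallel hne hl hs ht
  have : Nonempty G'.V := ⟨π.onV (G.src e)⟩
  have := (π.full hπ hG).card_le
  omega

/-- The graph obtained by identifying vertices along a map. -/
def mapVertices (G : RoseGraph n) {V' : Type} (p : G.V → V') : RoseGraph n where
  V := V'
  E := G.E
  src e := p (G.src e)
  tgt e := p (G.tgt e)
  label := G.label

/-- The quotient morphism which identifies vertices. -/
def mapVerticesHom (G : RoseGraph n) {V' : Type} (p : G.V → V') : Hom G (G.mapVertices p) where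
  onV := p
  onE e := e
  src_onE _ := rfl
  tgt_onE _ := rfl
  label_onE _ := rfl

/-- Two edges with the same label, a common start and different ends can be folded. -/
theorem exists_fold (G : RoseGraph n) [Finite G.V] [Finite G.E] {e₁ e₂ : G.E} {b : Bool}
    (hne : e₁ ≠ e₂) (hl : G.label e₁ = G.label e₂) (hs : G.start (e₁, b) = G.start (e₂, b))
    (hw : G.finish (e₁, b) ≠ G.finish (e₂, b)) :
    ∃ (G' : RoseGraph n) (π : Hom G G'), Function.Surjective π.onV ∧ Finite G'.V ∧ Finite G'.E ∧
      Nat.card G.V = Nat.card G'.V + 1 ∧ Nat.card G.E = Nat.card G'.E + 1 ∧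
      ∀ x x', π.onE x = π.onE x' → x = x' ∨ (x = e₂ ∧ x' = e₁) ∨ (x = e₁ ∧ x' = e₂) := by
  classical
  set w₁ := G.finish (e₁, b) with hw₁
  set w₂ := G.finish (e₂, b) with hw₂
  obtain ⟨p, hp, hpw⟩ : ∃ p : G.V → {v // v ≠ w₂}, Function.Surjective p ∧ p w₁ = p w₂ :=
    ⟨fun v => if h : v = w₂ then ⟨w₁, hw⟩ else ⟨v, h⟩, fun v => ⟨v.1, by simp [v.2]⟩,
      by simp [hw]⟩
  have hpar : (G.mapVertices p).src e₁ = (G.mapVertices p).src e₂ ∧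
      (G.mapVertices p).tgt e₁ = (G.mapVertices p).tgt e₂ := by
    cases b
    · exact ⟨hpw, congrArg p hs⟩
    · exact ⟨congrArg p hs, hpw⟩
  have : Finite (G.mapVertices p).V := Subtype.finite (α := G.V)
  have : Finite (G.mapVertices p).E := ‹Finite G.E›
  obtain ⟨G', π, hπ, h₁, h₂, hV, hE, hx⟩ :=
    (G.mapVertices p).exists_collapse_parallel hne hl hpar.1 hpar.2
  exact ⟨G', π.comp (G.mapVerticesHom p), hπ.comp hp, h₁, h₂,
    (card_subtype_ne w₂).trans (congrArg (· + 1) hV), hE, hx⟩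

/-- A graph which maps to a graph of the right Euler characteristic whose fundamental group maps
onto the free group, and which meets at least two vertices there, has a colouring of its vertices
which all letters except for one respect. -/
theorem exists_colouring {C : RoseGraph n} (N : ℕ) : ∀ (G : RoseGraph n), Finite G.V →
    Finite G.E → Nat.card G.E = N → G.Full → Nat.card G.E + 1 ≤ Nat.card G.V + n →
    ∀ c : Hom C G, (∃ u u', c.onV u ≠ c.onV u') →
    ∃ (κ : Type) (col : C.V → κ) (s : Letter n), (∃ u u', col u ≠ col u') ∧
      ∀ y ≠ s, ∀ u u', y ∈ C.letters u → y ∈ C.letters u' → col u = col u' := by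
  classical
  induction N with
  | zero =>
    intro G _ _ hN hG _ c ⟨u, u', huu⟩
    have : IsEmpty G.E := (Nat.card_eq_zero.1 hN).resolve_right (not_infinite_iff_finite.2 ‹_›)
    have := hG.subsingleton_of_folded fun e => isEmptyElim e
    exact absurd (Subsingleton.elim _ _) huu
  | succ N ih =>
  intro G _ _ hN hG hc c ⟨u, u', huu⟩
  have hnf : ¬ G.Folded := fun h => by
    have := hG.subsingleton_of_folded h
    exact huu (Subsingleton.elim _ _)
  unfold Folded at hnf
  push Not at hnf
  obtain ⟨e₁, e₂, b, hl, hs, hne⟩ := hnf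
  have hw : G.finish (e₁, b) ≠ G.finish (e₂, b) := fun h => hne <| by
    cases b
    · exact hG.eq_of_parallel hc hl h hs
    · exact hG.eq_of_parallel hc hl hs h
  obtain ⟨G₂, q, hq, hfV, hfE, hV, hE, hqE⟩ := G.exists_fold hne hl hs hw
  have hfull : G₂.Full := q.full hq hG
  by_cases hcol : ∃ u u', (q.comp c).onV u ≠ (q.comp c).onV u'
  · exact ih G₂ hfV hfE (by omega) hfull (by omega) (q.comp c) hcol
  push Not at hcol
  -- This fold is the first to send all of `C` to one vertex. The exceptional letter is the one read
  -- when a folded edge is crossed backwards from its end; these ends are the vertices being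
  -- identified.
  refine ⟨G.V, c.onV, (G.label e₁, !b), ⟨u, u', huu⟩, ?_⟩
  rintro ⟨i, b'⟩ hy v v' ⟨e, he, rfl⟩ ⟨e', he', rfl⟩
  -- After the fold, both edges are loops at the same vertex with the same label, so extremality
  -- makes them equal.
  have heq : (q.comp c).onE e = (q.comp c).onE e' := by
    refine hfull.eq_of_parallel (by omega) ?_ ?_ ?_
    · rw [Hom.label_onE, Hom.label_onE, he, he']
    · rw [Hom.src_onE, Hom.src_onE]; exact hcol _ _
    · rw [Hom.tgt_onE, Hom.tgt_onE]; exact hcol _ _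
  rw [← c.start_onE, ← c.start_onE]
  have hle := c.label_onE e
  have hle' := c.label_onE e'
  simp only at he he'
  have hb : G.label e₁ = i → b' = b := by
    rintro rfl
    by_contra hb
    exact hy (Prod.ext rfl (by cases b <;> cases b' <;> simp at hb ⊢))
  rcases hqE _ _ heq with h | ⟨h, h'⟩ | ⟨h, h'⟩
  · exact congrArg (fun x => G.start (x, b')) h
  · rw [h', h, hb (by rw [← h', hle', he'])]
    exact hs.symm
  · rw [h', h, hb (by rw [← h, hle, he])]
    exact hs

end RoseGraph

/-! ### From a colouring of the core to a cut vertex. -/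

/-- If `s` respects the colouring too, colours are constant on components of the Whitehead graph,
and an edge of the core with differently coloured ends has its letter and the inverse in different
components. Otherwise `s` joins letters at differently coloured vertices, and removing it separates
them. -/
theorem exists_isCutVertex_of_colouring {n : ℕ} {H : Subgroup (FreeGroup (Fin n))} {κ : Type}
    {col : (coreGraph H).V → κ} {s : Letter n} (hcol : ∃ u u', col u ≠ col u')
    (hs : ∀ y ≠ s, ∀ u u', y ∈ (coreGraph H).letters u → y ∈ (coreGraph H).letters u' →
      col u = col u') :
    ∃ a : Letter n, IsCutVertex (coreGraph H).whiteheadGraph a := by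
  by_cases hs' : ∀ u u', s ∈ (coreGraph H).letters u → s ∈ (coreGraph H).letters u' →
      col u = col u'
  · replace hs : ∀ y u u', y ∈ (coreGraph H).letters u → y ∈ (coreGraph H).letters u' →
        col u = col u' := fun y => by
      by_cases h : y = s
      · exact h ▸ hs'
      · exact hs y h
    obtain ⟨b, u, u', hb, hb', huu⟩ : ∃ (b : Letter n) (u u' : (coreGraph H).V),
        b ∈ (coreGraph H).letters u ∧ b.inv ∈ (coreGraph H).letters u' ∧ col u ≠ col u' := by
      by_contra! hc
      -- If the colour never changed across an edge, connectedness of the core would make it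
      -- constant.
      have key : ∀ (w : List (Letter n)) (u u' : (coreGraph H).V), Reads InCore u.1 w →
          u.1 ◃ FreeGroup.mk w = u'.1 → col u = col u' := by
        intro w
        induction w with
        | nil =>
          intro u u' _ h
          rw [act_mk_nil] at h
          rw [Subtype.ext h]
        | cons y w ih =>
          intro u u' h h'
          rw [act_mk_cons] at h'
          rw [← ih h.1.inv.vertex u' h.2 h']
          exact hc y _ _ (mem_letters_iff.2 h.1) (mem_letters_iff.2 h.1.inv)
      obtain ⟨u, u', huu⟩ := hcol
      obtain ⟨g, hg⟩ := exists_act_eq u.1 u'.1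
      obtain ⟨y, hy⟩ := exists_inCore u
      obtain ⟨z, hz⟩ := exists_inCore u'
      rw [← mk_toWord (x := g)] at hg
      exact huu (key g.toWord u u' (reads_inCore hy hz isReduced_toWord hg) hg)
    refine ⟨b, ?_, Or.inl ?_⟩
    · obtain ⟨z, hz, hzb⟩ := exists_mem_letters_ne u b
      exact ⟨z, hzb.symm, u, hb, hz⟩
    · rintro ⟨p⟩
      have key : ∀ {x y : Letter n} (p : (coreGraph H).whiteheadGraph.Walk x y) (u u'),
          x ∈ (coreGraph H).letters u → y ∈ (coreGraph H).letters u' → col u = col u' := by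
        intro x y p
        induction p with
        | nil => exact hs _
        | cons h _ ih =>
          intro u u' hu hu'
          obtain ⟨-, v, hv, hv'⟩ := h
          rw [hs _ _ _ hu hv]
          exact ih _ _ hv' hu'
      exact huu (key p u u' hb hb')
  · push Not at hs'
    obtain ⟨u, u', hu, hu', huu⟩ := hs'
    obtain ⟨y, hy, hys⟩ := exists_mem_letters_ne u s
    obtain ⟨z, hz, hzs⟩ := exists_mem_letters_ne u' s
    have hsy : (coreGraph H).whiteheadGraph.Adj s y := ⟨hys.symm, u, hu, hy⟩
    have hsz : (coreGraph H).whiteheadGraph.Adj s z := ⟨hzs.symm, u', hu', hz⟩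
    refine ⟨s, ⟨y, hsy⟩, Or.inr fun hconn => ?_⟩
    obtain ⟨p⟩ := hconn.preconnected ⟨y, hsy.reachable, hys⟩ ⟨z, hsz.reachable, hzs⟩
    have key : ∀ {x y} (p : ((coreGraph H).whiteheadGraph.induce
        {y | (coreGraph H).whiteheadGraph.Reachable s y ∧ y ≠ s}).Walk x y) (u u'),
          x.1 ∈ (coreGraph H).letters u → y.1 ∈ (coreGraph H).letters u' → col u = col u' := by
      intro x y p
      induction p with
      | @nil x => exact hs _ x.2.2
      | @cons x _ _ h _ ih =>
        intro u u' hu hu'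
        obtain ⟨-, v, hv, hv'⟩ := h
        rw [hs _ x.2.2 _ _ hu hv]
        exact ih _ _ hv' hu'
    exact huu (key p u u' hy hz)

/-! ### Generation by a basis, and its cardinality. -/

namespace FreeGroupBasis
variable {ι G : Type*} [Group G]

theorem closure_range (b : FreeGroupBasis ι G) : Subgroup.closure (Set.range b) = ⊤ := by
  have h : Set.range b = b.repr.symm.toMonoidHom '' Set.range (FreeGroup.of : ι → FreeGroup ι) := by
    rw [← Set.range_comp]
    congr 1
  rw [h, ← MonoidHom.map_closure, FreeGroup.closure_range_of, Subgroup.map_top_of_surjective]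
  exact b.repr.symm.surjective

/-- Count homomorphisms to the group of order two: a basis indexed by `ι` puts them in bijection
with the functions from `ι` to that group. -/
theorem finite_and_card_eq {n : ℕ} (b : FreeGroupBasis ι (FreeGroup (Fin n))) :
    Finite ι ∧ Nat.card ι = n := by
  classical
  let e : (ι → Multiplicative (ZMod 2)) ≃ (Fin n → Multiplicative (ZMod 2)) :=
    b.lift.trans FreeGroup.lift.symm
  have hfin : Finite (ι → Multiplicative (ZMod 2)) := Finite.of_equiv _ e.symm
  have hι : Finite ι := by
    refine Finite.of_injective
      (fun i j => if i = j then Multiplicative.ofAdd (1 : ZMod 2) else 1) fun i j h => ?_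
    by_contra hij
    have := congrFun h i
    simp only [if_true, if_neg (Ne.symm hij)] at this
    exact absurd this (by decide)
  refine ⟨hι, ?_⟩
  have h := Nat.card_congr e
  rw [Nat.card_fun, Nat.card_fun, Nat.card_fin] at h
  have h2 : Nat.card (Multiplicative (ZMod 2)) = 2 := by simp
  rw [h2] at h
  exact Nat.pow_right_injective le_rfl h

end FreeGroupBasis

/-! ### Cochains and the Euler characteristic of the core. -/

section PathSum
variable {n : ℕ} {H : Subgroup (FreeGroup (Fin n))}

/-- The value of a 1-cochain on the edge which leaves `v` along the letter `y`. -/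
def letterSum (c : (coveringGraph H).V → Fin n → ℚ) (v : (coveringGraph H).V) (y : Letter n) : ℚ :=
  if y.2 then c v y.1 else -c (v ◃ FreeGroup.mk [y]) y.1

/-- The value of a 1-cochain on an edge path. -/
def pathSum (c : (coveringGraph H).V → Fin n → ℚ) : (coveringGraph H).V → List (Letter n) → ℚ
  | _, [] => 0
  | v, y :: w => letterSum c v y + pathSum c (v ◃ FreeGroup.mk [y]) w

variable (c : (coveringGraph H).V → Fin n → ℚ)

theorem letterSum_inv (v : (coveringGraph H).V) (y : Letter n) :
    letterSum c (v ◃ FreeGroup.mk [y]) y.inv = -letterSum c v y := by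
  have h := act_letter_inv v y
  rcases y with ⟨i, _ | _⟩
  · simp [letterSum, Letter.inv]
  · simp only [Letter.inv, Bool.not_true] at h
    simp [letterSum, Letter.inv, h]

theorem pathSum_append (v : (coveringGraph H).V) (a b : List (Letter n)) :
    pathSum c v (a ++ b) = pathSum c v a + pathSum c (v ◃ FreeGroup.mk a) b := by
  induction a generalizing v with
  | nil => simp [pathSum]
  | cons y a ih => simp [pathSum, ih, act_mk_cons v y a, add_assoc]

/-- A backtrack contributes opposite values, so the sum depends only on the group element read. -/
theorem pathSum_reduce (v : (coveringGraph H).V) (w : List (Letter n)) :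
    pathSum c v (reduce w) = pathSum c v w := by
  have key : ∀ {a b : List (Letter n)}, Red.Step a b → pathSum c v b = pathSum c v a := by
    rintro _ _ ⟨⟩
    rename_i L₁ L₂ x b
    have h1 := act_letter_inv (v ◃ FreeGroup.mk L₁) (x, b)
    have h2 := letterSum_inv c (v ◃ FreeGroup.mk L₁) (x, b)
    rw [Letter.inv] at h1 h2
    rw [pathSum_append, pathSum_append, pathSum, pathSum, h1, h2]
    ring
  have hr : Red w (reduce w) := reduce.red
  generalize reduce w = w' at hr
  induction hr with
  | refl => rfl
  | tail _ hs ih => rw [key hs, ih]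

theorem pathSum_mul (v : (coveringGraph H).V) (g h : FreeGroup (Fin n)) :
    pathSum c v (g * h).toWord = pathSum c v g.toWord + pathSum c (v ◃ g) h.toWord := by
  rw [toWord_mul, pathSum_reduce, pathSum_append, mk_toWord]

theorem pathSum_add (c c' : (coveringGraph H).V → Fin n → ℚ) (v : (coveringGraph H).V)
    (w : List (Letter n)) : pathSum (c + c') v w = pathSum c v w + pathSum c' v w := by
  induction w generalizing v with
  | nil => simp [pathSum]
  | cons y w ih =>
    simp only [pathSum, ih, letterSum]
    split_ifs <;> simp <;> ring

theorem pathSum_smul (r : ℚ) (v : (coveringGraph H).V) (w : List (Letter n)) :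
    pathSum (r • c) v w = r * pathSum c v w := by
  induction w generalizing v with
  | nil => simp [pathSum]
  | cons y w ih =>
    simp only [pathSum, ih, letterSum]
    split_ifs <;> simp <;> ring

/-- A 1-cochain which vanishes on generators of the fundamental group is a coboundary. -/
theorem exists_coboundary {S : Set (FreeGroup (Fin n))} (hS : Subgroup.closure S = H)
    (h0 : ∀ s ∈ S, pathSum c (cosetMk H 1) s.toWord = 0) :
    ∃ f : (coveringGraph H).V → ℚ, ∀ v i, c v i = f (v ◃ FreeGroup.of i) - f v := by
  have hone : ∀ v, pathSum c v (1 : FreeGroup (Fin n)).toWord = 0 := fun v => by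
    rw [toWord_one]; rfl
  have hH : ∀ g ∈ H, pathSum c (cosetMk H 1) g.toWord = 0 := by
    intro g hg
    rw [← hS] at hg
    induction hg using Subgroup.closure_induction with
    | mem s hs => exact h0 s hs
    | one => exact hone _
    | mul x y hx hy ihx ihy =>
      rw [hS] at hx
      rw [pathSum_mul, ihx, act_cosetMk_one.2 hx, ihy, add_zero]
    | inv x hx ihx =>
      rw [hS] at hx
      have h1 := pathSum_mul c (cosetMk H 1) x x⁻¹
      rw [mul_inv_cancel, hone, ihx, act_cosetMk_one.2 hx, zero_add] at h1
      exact h1.symm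
  -- The potential at `v` is the sum along any path from the base vertex; vanishing on `H` makes it
  -- independent of the path.
  choose g hg using fun v => exists_act_eq (cosetMk H 1) v
  have key : ∀ v x, cosetMk H 1 ◃ x = v →
      pathSum c (cosetMk H 1) x.toWord = pathSum c (cosetMk H 1) (g v).toWord := by
    intro v x hx
    have h1 : cosetMk H 1 ◃ (x * (g v)⁻¹) = cosetMk H 1 := by
      rw [← act_act, hx, ← hg v, act_act, hg v, mul_inv_cancel, act_one]
    have h2 := pathSum_mul c (cosetMk H 1) (x * (g v)⁻¹) (g v)
    rwa [inv_mul_cancel_right, hH _ (act_cosetMk_one.1 h1), h1, zero_add] at h2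
  refine ⟨fun v => pathSum c (cosetMk H 1) (g v).toWord, fun v i => ?_⟩
  beta_reduce
  rw [← key (v ◃ FreeGroup.of i) (g v * FreeGroup.of i) (by rw [← act_act, hg]),
    pathSum_mul, hg, toWord_of]
  simp [pathSum, letterSum]

open Classical in
/-- The number of edges of the core graph is bounded by the number of vertices and the number
of generators. -/
theorem card_coreGraph_E_le {ι : Type*} [Finite ι] (y : ι → FreeGroup (Fin n))
    (hy : Subgroup.closure (Set.range y) = H) [Finite (coreGraph H).V] [Finite (coreGraph H).E]
    [Nonempty (coreGraph H).V] :
    Nat.card (coreGraph H).E + 1 ≤ Nat.card (coreGraph H).V + Nat.card ι := by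
  have := Fintype.ofFinite ι
  have := Fintype.ofFinite (coreGraph H).V
  have := Fintype.ofFinite (coreGraph H).E
  let ext : ((coreGraph H).E → ℚ) → (coveringGraph H).V → Fin n → ℚ :=
    fun c v i => if h : InCore v (i, true) then c h.edge else 0
  have hadd : ∀ c c', ext (c + c') = ext c + ext c' := fun c c' => by
    ext v i
    simp only [ext, Pi.add_apply]
    split_ifs <;> simp
  have hsmul : ∀ (r : ℚ) c, ext (r • c) = r • ext c := fun r c => by
    ext v i
    simp only [ext, Pi.smul_apply]
    split_ifs <;> simp
  let T : ((coreGraph H).E → ℚ) →ₗ[ℚ] (ι → ℚ) :=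
    { toFun := fun c j => pathSum (ext c) (cosetMk H 1) (y j).toWord
      map_add' := fun c c' => by ext j; simp [hadd, pathSum_add]
      map_smul' := fun r c => by ext j; simp [hsmul, pathSum_smul] }
  let d : ((coreGraph H).V → ℚ) →ₗ[ℚ] ((coreGraph H).E → ℚ) :=
    { toFun := fun f e => f ((coreGraph H).tgt e) - f ((coreGraph H).src e)
      map_add' := fun f g => by ext e; simp; ring
      map_smul' := fun r f => by ext e; simp; ring }
  -- Cochains vanishing on the generators are coboundaries, so the kernel of `T` has dimension at
  -- least `E - |ι|` and at most `V - 1`, since constants lie in the kernel of `d`.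
  have hle : LinearMap.ker T ≤ LinearMap.range d := by
    intro c hc
    obtain ⟨f, hf⟩ := exists_coboundary (ext c) hy (by
      rintro _ ⟨j, rfl⟩
      exact congrFun hc j)
    refine ⟨fun v => f v.1, ?_⟩
    ext e
    have h1 := edgeInCore_iff.1 e.2
    have h2 := hf e.1.1 e.1.2
    have h3 : ext c e.1.1 e.1.2 = c e := dif_pos h1
    rw [h3] at h2
    exact h2.symm
  have h1 := T.finrank_range_add_finrank_ker
  have h2 := (LinearMap.range T).finrank_le
  have h3 := d.finrank_range_add_finrank_ker
  have h4 := Submodule.finrank_mono hle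
  have h5 : 0 < Module.finrank ℚ (LinearMap.ker d) := by
    rw [Module.finrank_pos_iff, Submodule.nontrivial_iff_ne_bot, Submodule.ne_bot_iff]
    refine ⟨1, ?_, one_ne_zero⟩
    ext e
    simp [d]
  simp only [Module.finrank_fintype_fun_eq_card] at h1 h2 h3
  rw [Nat.card_eq_fintype_card, Nat.card_eq_fintype_card, Nat.card_eq_fintype_card]
  omega

end PathSum

/-! ### Attaching paths and loops. -/

namespace RoseGraph
variable {n : ℕ}

/-- The graph obtained by adding an edge from `u` to `v` which is crossed along the letter `y`. -/
def addEdge (G : RoseGraph n) (u v : G.V) (y : Letter n) : RoseGraph n where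
  V := G.V
  E := Option G.E
  src e := e.elim (if y.2 then u else v) G.src
  tgt e := e.elim (if y.2 then v else u) G.tgt
  label e := e.elim y.1 G.label

/-- The inclusion of a graph into the graph with an additional edge. -/
def addEdgeHom (G : RoseGraph n) (u v : G.V) (y : Letter n) : Hom G (G.addEdge u v y) where
  onV v := v
  onE := some
  src_onE _ := rfl
  tgt_onE _ := rfl
  label_onE _ := rfl

theorem linked_addEdge (G : RoseGraph n) (u v : G.V) (y : Letter n) :
    (G.addEdge u v y).Linked u v (FreeGroup.mk [y]) := by
  have := (G.addEdge u v y).linked_dart (none, y.2)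
  rcases y with ⟨i, _ | _⟩ <;> exact this

/-- A path which reads a given word can be attached to a graph. -/
theorem exists_arc (w : List (Letter n)) (hw : w ≠ []) : ∀ (G : RoseGraph n), Finite G.V →
    Finite G.E → ∀ u v : G.V, ∃ (G' : RoseGraph n) (φ : Hom G G'), Function.Injective φ.onV ∧
      Finite G'.V ∧ Finite G'.E ∧ Nat.card G'.E + Nat.card G.V = Nat.card G.E + Nat.card G'.V + 1 ∧
      (∀ x, ∃ u g, G'.Linked (φ.onV u) x g) ∧
      G'.Linked (φ.onV u) (φ.onV v) (FreeGroup.mk w) := by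
  induction w with
  | nil => exact absurd rfl hw
  | cons y w ih =>
  intro G hV hE u v
  by_cases hw' : w = []
  · subst hw'
    refine ⟨G.addEdge u v y, G.addEdgeHom u v y, Function.injective_id, hV,
      inferInstanceAs (Finite (Option G.E)), ?_, fun x => ⟨x, 1, .refl⟩, linked_addEdge G u v y⟩
    have h : Nat.card (G.addEdge u v y).E = Nat.card G.E + 1 := Finite.card_option (α := G.E)
    change Nat.card (G.addEdge u v y).E + Nat.card G.V = Nat.card G.E + Nat.card G.V + 1
    omega
  -- Add a new vertex `none` at the end of the first edge. This adds one vertex and one edge; only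
  -- the closing edge of the arc lacks a matching vertex.
  · set G₁ := G.mapVertices (some : G.V → Option G.V) with hG₁
    set G₂ := G₁.addEdge (some u) none y with hG₂
    have h₁ : Nat.card G₂.V = Nat.card G.V + 1 := Finite.card_option (α := G.V)
    have h₂ : Nat.card G₂.E = Nat.card G.E + 1 := Finite.card_option (α := G.E)
    obtain ⟨G', φ, hφ, hV', hE', hc, hx, hl⟩ := ih hw' G₂ (inferInstanceAs (Finite (Option G.V)))
      (inferInstanceAs (Finite (Option G.E))) none (some v)
    have hy : G'.Linked (φ.onV (some u)) (φ.onV none) (FreeGroup.mk [y]) :=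
      φ.linked (linked_addEdge G₁ (some u) none y)
    let ψ : Hom G G₂ := (G₁.addEdgeHom (some u) none y).comp (G.mapVerticesHom some)
    refine ⟨G', φ.comp ψ, hφ.comp (Option.some_injective G.V), hV', hE', by omega, fun x => ?_, ?_⟩
    · obtain ⟨z, g, hz⟩ := hx x
      change Option G.V at z
      rcases z with _ | z
      · exact ⟨u, _, hy.trans hz⟩
      · exact ⟨z, g, hz⟩
    · have := hy.trans hl
      rwa [FreeGroup.mul_mk] at this

/-- Loops which read given elements of the free group can be attached to a graph. -/
theorem exists_attach_loops (l : List (FreeGroup (Fin n))) : ∀ (G : RoseGraph n), Finite G.V →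
    Finite G.E → ∀ u : G.V, ∃ (G' : RoseGraph n) (φ : Hom G G'), Function.Injective φ.onV ∧
      Finite G'.V ∧ Finite G'.E ∧
      Nat.card G'.E + Nat.card G.V ≤ Nat.card G.E + Nat.card G'.V + l.length ∧
      (∀ x, ∃ u g, G'.Linked (φ.onV u) x g) ∧
      ∀ z ∈ l, G'.Linked (φ.onV u) (φ.onV u) z := by
  induction l with
  | nil =>
    intro G hV hE u
    exact ⟨G, ⟨id, id, fun _ => rfl, fun _ => rfl, fun _ => rfl⟩, Function.injective_id, hV, hE,
      le_rfl, fun x => ⟨x, 1, .refl⟩, by simp⟩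
  | cons z l ih =>
    intro G hV hE u
    obtain ⟨G₁, φ, hφ, hV₁, hE₁, hc, hx, hl⟩ := ih G hV hE u
    -- The trivial element has an empty word and needs no arc, hence only an inequality in the
    -- count.
    by_cases hz : z = 1
    · subst hz
      refine ⟨G₁, φ, hφ, hV₁, hE₁, by simp only [List.length_cons]; omega, hx, fun z hz => ?_⟩
      rcases List.mem_cons.1 hz with rfl | hz
      · exact .refl
      · exact hl z hz
    · obtain ⟨G₂, ψ, hψ, hV₂, hE₂, hc₂, hx₂, hl₂⟩ := exists_arc z.toWord
        (fun h => hz (toWord_eq_nil_iff.1 h)) G₁ hV₁ hE₁ (φ.onV u) (φ.onV u)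
      refine ⟨G₂, ψ.comp φ, hψ.comp hφ, hV₂, hE₂, by simp only [List.length_cons]; omega,
        fun x => ?_, fun z' hz' => ?_⟩
      · obtain ⟨y, g, hg⟩ := hx₂ x
        obtain ⟨v, g', hg'⟩ := hx y
        exact ⟨v, _, (ψ.linked hg').trans hg⟩
      · rcases List.mem_cons.1 hz' with rfl | hz'
        · rwa [mk_toWord] at hl₂
        · exact ψ.linked (hl z' hz')

end RoseGraph

/-! ### Free factors and the proof of the theorem. -/

theorem linked_coreGraph {n : ℕ} {H : Subgroup (FreeGroup (Fin n))} {u v : (coreGraph H).V}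
    {g : FreeGroup (Fin n)} (h : u.1 ◃ g = v.1) : (coreGraph H).Linked u v g := by
  have key : ∀ (w : List (Letter n)) (u v : (coreGraph H).V), Reads InCore u.1 w →
      u.1 ◃ FreeGroup.mk w = v.1 → (coreGraph H).Linked u v (FreeGroup.mk w) := by
    intro w
    induction w with
    | nil =>
      intro u v _ h
      rw [act_mk_nil] at h
      obtain rfl := Subtype.ext h
      exact .refl
    | cons y w ih =>
      intro u v h h'
      rw [act_mk_cons] at h'
      have h1 := ih h.1.inv.vertex v h.2 h'
      obtain ⟨e, he, hu⟩ := mem_letters_iff.2 h.1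
      have h2 := (coreGraph H).linked_dart (e, y.2)
      have h3 : (coreGraph H).finish (e, y.2) = h.1.inv.vertex := by
        apply Subtype.ext
        change _ = u.1 ◃ FreeGroup.mk [y]
        have h4 := finish_eq (H := H) (e.1, y.2)
        have h5 : (coveringGraph H).start (e.1, y.2) = u.1 := by
          rw [← hu]; rcases y with ⟨i, _ | _⟩ <;> rfl
        have h6 : dartLetter (H := H) (e.1, y.2) = y := Prod.ext he rfl
        rw [h5, h6] at h4
        rw [← h4]
        rcases y with ⟨i, _ | _⟩ <;> rfl
      rw [hu, h3, he] at h2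
      have := h2.trans h1
      rwa [FreeGroup.mul_mk] at this
  obtain ⟨y, hy⟩ := exists_inCore u
  obtain ⟨z, hz⟩ := exists_inCore v
  rw [← mk_toWord (x := g)] at h ⊢
  exact key _ u v (reads_inCore hy hz isReduced_toWord h) h

/-- All that the argument uses of a free factor: generators of `H` and complementary elements, `n`
in number, which together generate. -/
theorem IsFreeFactor.fg {n : ℕ} {H : Subgroup (FreeGroup (Fin n))} (hH : IsFreeFactor H) :
    ∃ (ι κ : Type) (y : ι → FreeGroup (Fin n)) (z : κ → FreeGroup (Fin n)), Finite ι ∧ Finite κ ∧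
      Nat.card ι + Nat.card κ = n ∧ Subgroup.closure (Set.range y) = H ∧
      Subgroup.closure (Set.range y ∪ Set.range z) = ⊤ := by
  obtain ⟨ι, κ, bH, bG, h⟩ := hH
  obtain ⟨hf, hc⟩ := bG.finite_and_card_eq
  have hι : Finite ι := Finite.of_injective (Sum.inl : ι → ι ⊕ κ) Sum.inl_injective
  have hκ : Finite κ := Finite.of_injective (Sum.inr : κ → ι ⊕ κ) Sum.inr_injective
  refine ⟨ι, κ, fun i => bG (Sum.inl i), fun k => bG (Sum.inr k), hι, hκ, ?_, ?_, ?_⟩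
  · rw [← hc, Nat.card_sum]
  · have h1 := congrArg (Subgroup.map H.subtype) bH.closure_range
    rw [MonoidHom.map_closure, ← MonoidHom.range_eq_map, Subgroup.range_subtype] at h1
    rw [← h1, ← Set.range_comp]
    congr 2
    ext i
    exact h i
  · rw [← bG.closure_range]
    congr 1
    ext g
    simp

theorem exists_isCutVertex_of_isFreeFactor {n : ℕ} {H : Subgroup (FreeGroup (Fin n))}
    (hH : IsFreeFactor H) (hfg : H.FG) (h1 : 1 < ENat.card (coreGraph H).V) :
    ∃ a : Letter n, IsCutVertex (coreGraph H).whiteheadGraph a := by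
  have hV := finite_coreGraph_V hfg
  have hE := finite_coreGraph_E hfg
  have : Nontrivial (coreGraph H).V := by rwa [← ENat.one_lt_card_iff_nontrivial]
  obtain ⟨ι, κ, y, z, _, _, hn, hy, hyz⟩ := hH.fg
  obtain ⟨u₁, u₂, hne⟩ := exists_pair_ne (coreGraph H).V
  -- The base coset need not lie in the core, so everything is conjugated by `g` to be read at `u₁`.
  obtain ⟨g, hg⟩ := exists_act_eq (cosetMk H 1) u₁.1
  have := Fintype.ofFinite κ
  obtain ⟨G, φ, hφ, hGV, hGE, hc, hx, hl⟩ := RoseGraph.exists_attach_loops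
    (Finset.univ.toList.map fun k : κ => g⁻¹ * z k * g) (coreGraph H) hV hE u₁
  have hcard := card_coreGraph_E_le y hy
  rw [List.length_map, Finset.length_toList, Finset.card_univ, ← Nat.card_eq_fintype_card] at hc
  have hconj : ∀ x : FreeGroup (Fin n), G.Linked (φ.onV u₁) (φ.onV u₁) (g⁻¹ * x * g) := by
    intro x
    have hx : x ∈ Subgroup.closure (Set.range y ∪ Set.range z) := hyz ▸ Subgroup.mem_top x
    induction hx using Subgroup.closure_induction with
    | mem x hx =>
      rcases hx with ⟨j, rfl⟩ | ⟨k, rfl⟩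
      · refine φ.linked (linked_coreGraph ?_)
        have hj : y j ∈ H := hy ▸ Subgroup.subset_closure ⟨j, rfl⟩
        rw [← hg, act_act, show g * (g⁻¹ * y j * g) = y j * g by group, ← act_act,
          act_cosetMk_one.2 hj]
      · exact hl _ (by simp)
    | one => simpa using RoseGraph.Linked.refl
    | mul a b _ _ iha ihb =>
      have := iha.trans ihb
      rwa [show g⁻¹ * a * g * (g⁻¹ * b * g) = g⁻¹ * (a * b) * g by group] at this
    | inv a _ iha =>
      have := iha.symm
      rwa [show (g⁻¹ * a * g)⁻¹ = g⁻¹ * a⁻¹ * g by group] at this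
  have hbase : ∀ x : G.V, ∃ r, G.Linked (φ.onV u₁) x r := by
    intro x
    obtain ⟨v, r, hr⟩ := hx x
    obtain ⟨s, hs⟩ := exists_act_eq u₁.1 v.1
    exact ⟨_, (φ.linked (linked_coreGraph hs)).trans hr⟩
  have hfull : G.Full := by
    intro u v x
    obtain ⟨r, hr⟩ := hbase u
    obtain ⟨s, hs⟩ := hbase v
    have := (hr.symm.trans (hconj (g * (r * x * s⁻¹) * g⁻¹))).trans hs
    rwa [show r⁻¹ * (g⁻¹ * (g * (r * x * s⁻¹) * g⁻¹) * g) * s = x by group] at this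
  obtain ⟨_, _, _, hcol, hs⟩ := RoseGraph.exists_colouring _ G hGV hGE rfl hfull (by omega) φ
    ⟨u₁, u₂, fun h => hne (hφ h)⟩
  exact exists_isCutVertex_of_colouring hcol hs

theorem mainTheorem3 (n : ℕ) (H : Subgroup (FreeGroup (Fin n))) (hH : IsFreeFactor H) :
    (1 < ENat.card (coreGraph H).V →
      (∃ a : Letter n, IsCutVertex (coreGraph H).whiteheadGraph a) ∧
      ∃ P : WhiteheadPair n, StrictlyReduces P H ∧
        ∀ v : (coreGraph H).V, Trichotomy P (coreGraph H) v) ∧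
    ((∃ a : Letter n, IsCutVertex (coreGraph H).whiteheadGraph a) →
      ∃ P : WhiteheadPair n, StrictlyReduces P H ∧
        ∀ v : (coreGraph H).V, Trichotomy P (coreGraph H) v) := by
  have hfg : H.FG := by
    obtain ⟨ι, κ, y, z, _, _, -, hy, -⟩ := hH.fg
    exact (Subgroup.fg_iff _).2 ⟨_, hy, Set.finite_range y⟩
  refine ⟨fun h => ?_, fun ⟨a, ha⟩ => exists_strictlyReduces_of_isCutVertex hfg ha⟩
  obtain ⟨a, ha⟩ := exists_isCutVertex_of_isFreeFactor hH hfg h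
  exact ⟨⟨a, ha⟩, exists_strictlyReduces_of_isCutVertex hfg ha⟩
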